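/- A formal game is a finite game tree $G=\{G^L\mid G^R\}$ with finitely many Left options $G^L$ and Right options $G^R$ (short normal-play games). Write $G\le H$ if there is no $G^L$ with $H\le G^L$ and no $H^R$ with $H^R\le G$; write $G=H$ if $G\le H$ and $H\le G$ (the class of $G$ is its value); and say that $G$ is greater than or fuzzy with $H$ if $H\le G\not\le H$ or $G,H$ are incomparable, i.e. if $G\not\le H$. Sums and negatives of games are the disjunctive ones, and a dyadic rational $x\in\mathbb{Z}[\tfrac12]$ is identified, as a game, with its canonical form. For $t\in\mathbb{Z}[\tfrac12]$ define $\lambda_t(G),\rho_t(G)\in\mathbb{Z}[\tfrac12]$, the temperature $t(G)\in\mathbb{Z}[\tfrac12]\cup\{-\infty\}$ and the cooled game $G_t$ recursively. If $G$ is equal to an integer $n$, put $\lambda_t(G)=\rho_t(G)=n$, $G_t=n$ and $t(G)=-\infty$. Otherwise let $$\widetilde\lambda_t(G)=\max_{G^L}\bigl(\rho_t(G^L)-t\bigr),\qquad \widetilde\rho_t(G)=\min_{G^R}\bigl(\lambda_t(G^R)+t\bigr),\qquad \widetilde G_t=\{(G^L)_t-t\mid (G^R)_t+t\},$$ let $t(G)$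 be the least $t\in\mathbb{Z}[\tfrac12]$ with $\widetilde\lambda_t(G)=\widetilde\rho_t(G)$ (it exists), and let $x$ be the common value $\widetilde\lambda_{t(G)}(G)=\widetilde\rho_{t(G)}(G)$; put $\lambda_t(G)=\widetilde\lambda_t(G)$, $\rho_t(G)=\widetilde\rho_t(G)$, $G_t=\widetilde G_t$ if $t\le t(G)$, and $\lambda_t(G)=\rho_t(G)=x$, $G_t=x$ if $t>t(G)$. **Theorem.** Let $t\in\mathbb{Z}[\tfrac12]$ with $t>-1$. For all formal games $G,H$: 1. if $G\ge H$, then $G_t\ge H_t$; 2. if $G$ is greater than or fuzzy with $H$, then $G_t$ is greater than or fuzzy with $H_t-t$; 3. consequently, if $G=H$ then $G_t=H_t$, and there is a unique map from game values to game values that sends the value of $G$ to the value of $G_t$ for every formal game $G$. -/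

import Mathlib

/-- The ring `ℤ[1/2]` of dyadic rationals, as a subring of `ℚ`. -/
def ZHalf : Subring ℚ where
  carrier := {q | ∃ (k : ℤ) (n : ℕ), q = (k : ℚ) / 2 ^ n}
  mul_mem' := by
    rintro _ _ ⟨k, n, rfl⟩ ⟨k', n', rfl⟩
    exact ⟨k * k', n + n', by push_cast; rw [pow_add]; field_simp⟩
  one_mem' := ⟨1, 0, by simp⟩
  add_mem' := by
    rintro _ _ ⟨k, n, rfl⟩ ⟨k', n', rfl⟩
    exact ⟨k * 2 ^ n' + k' * 2 ^ n, n + n', by push_cast; rw [pow_add]; field_simp⟩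
  zero_mem' := ⟨0, 0, by simp⟩
  neg_mem' := by
    rintro _ ⟨k, n, rfl⟩
    exact ⟨-k, n, by push_cast; ring⟩

/-- Formal (short, normal-play) games `{G^L | G^R}`: finite game trees, a position being given by
a finite family of Left options and a finite family of Right options. -/
inductive FormalGame : Type
  | mk {m n : ℕ} (L : Fin m → FormalGame) (R : Fin n → FormalGame) : FormalGame

namespace FormalGame

/-- The number of Left options. -/
def numLeft : FormalGame → ℕ
  | @mk m _ _ _ => m

/-- The number of Right options. -/
def numRight : FormalGame → ℕ
  | @mk _ n _ _ => n

/-- The Left options. -/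
def left : (G : FormalGame) → Fin G.numLeft → FormalGame
  | mk L _ => L

/-- The Right options. -/
def right : (G : FormalGame) → Fin G.numRight → FormalGame
  | mk _ R => R

/-- The formal birthday: the height of the game tree. -/
def birthday : FormalGame → ℕ
  | mk L R => max (Finset.univ.sup fun i => birthday (L i) + 1)
      (Finset.univ.sup fun j => birthday (R j) + 1)

theorem birthday_left (G : FormalGame) (i : Fin G.numLeft) :
    (G.left i).birthday < G.birthday := by
  cases G with
  | mk L R =>
    rw [birthday]
    exact lt_max_of_lt_left (Nat.lt_of_succ_le
      (Finset.le_sup (f := fun i => birthday (L i) + 1) (Finset.mem_univ i)))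

theorem birthday_right (G : FormalGame) (j : Fin G.numRight) :
    (G.right j).birthday < G.birthday := by
  cases G with
  | mk L R =>
    rw [birthday]
    exact lt_max_of_lt_right (Nat.lt_of_succ_le
      (Finset.le_sup (f := fun i => birthday (R i) + 1) (Finset.mem_univ j)))

/-! ### The order -/

/-- `G ≤ H` if no Left option `G^L` satisfies `H ≤ G^L` and no Right option `H^R` satisfies
`H^R ≤ G`; that is, Left wins `H - G` if Right moves first. -/
def Le (G H : FormalGame) : Prop :=
  (∀ i, ¬ Le H (G.left i)) ∧ ∀ j, ¬ Le (H.right j) G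
termination_by G.birthday + H.birthday
decreasing_by
  · have := birthday_left G i; omega
  · have := birthday_right H j; omega

instance : LE FormalGame := ⟨Le⟩

theorem le_def (G H : FormalGame) :
    G ≤ H ↔ (∀ i, ¬ H ≤ G.left i) ∧ ∀ j, ¬ H.right j ≤ G := by
  change Le G H ↔ (∀ i, ¬ Le H (G.left i)) ∧ ∀ j, ¬ Le (H.right j) G
  rw [Le]

theorem le_refl' (G : FormalGame) : G ≤ G := by
  induction G with
  | mk L R ihL ihR =>
    rw [le_def]
    refine ⟨fun i h => ?_, fun j h => ?_⟩
    · exact ((le_def _ _).1 h).1 i (ihL i)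
    · exact ((le_def _ _).1 h).2 j (ihR j)

theorem le_trans' (G H K : FormalGame) (h₁ : G ≤ H) (h₂ : H ≤ K) : G ≤ K := by
  rw [le_def]
  refine ⟨fun i h => ?_, fun j h => ?_⟩
  · exact ((le_def _ _).1 h₁).1 i (le_trans' H K (G.left i) h₂ h)
  · exact ((le_def _ _).1 h₂).2 j (le_trans' (K.right j) G H h h₁)
termination_by G.birthday + H.birthday + K.birthday
decreasing_by
  · have := birthday_left G i; omega
  · have := birthday_right K j; omega

instance : Preorder FormalGame where
  le_refl := le_refl'
  le_trans := le_trans'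

/-- Equality of games (equality of their values), as opposed to identity of formal games:
`G ≤ H` and `H ≤ G`. -/
def Equal (G H : FormalGame) : Prop := AntisymmRel (· ≤ ·) G H

/-- `G` is greater than or fuzzy (incomparable) with `H`. -/
def GreaterOrFuzzy (G H : FormalGame) : Prop := H < G ∨ (¬ G ≤ H ∧ ¬ H ≤ G)

/-- The partially ordered set of game values: formal games modulo equality. -/
abbrev Value : Type := Antisymmetrization FormalGame (· ≤ ·)

/-- The value of a formal game. -/
def value (G : FormalGame) : Value := toAntisymmetrization (· ≤ ·) G

/-! ### The group operations -/

instance : Zero FormalGame := ⟨mk (m := 0) (n := 0) Fin.elim0 Fin.elim0⟩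

/-- `-G = {-G^R | -G^L}`. -/
def neg : FormalGame → FormalGame
  | mk L R => mk (fun j => neg (R j)) (fun i => neg (L i))

instance : Neg FormalGame := ⟨neg⟩

/-- The disjunctive sum `G + H = {G^L + H, G + H^L | G^R + H, G + H^R}`. -/
def add (G H : FormalGame) : FormalGame :=
  mk (Fin.append (fun i => add (G.left i) H) (fun i => add G (H.left i)))
    (Fin.append (fun j => add (G.right j) H) (fun j => add G (H.right j)))
termination_by G.birthday + H.birthday
decreasing_by
  · have := birthday_left G i; omega
  · have := birthday_left H i; omega
  · have := birthday_right G j; omega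
  · have := birthday_right H j; omega

instance : Add FormalGame := ⟨add⟩

/-- `G - H = G + (-H)`. -/
instance : Sub FormalGame := ⟨fun G H => G + -H⟩

/-! ### Canonical forms of numbers -/

/-- `0 = { | }` and `n + 1 = {n | }`. -/
def ofNat : ℕ → FormalGame
  | 0 => 0
  | n + 1 => mk (m := 1) (n := 0) (fun _ => ofNat n) Fin.elim0

/-- The canonical form of an integer. -/
def ofInt : ℤ → FormalGame
  | Int.ofNat n => ofNat n
  | Int.negSucc n => -ofNat (n + 1)

/-- The canonical form of `k / 2 ^ m`: for `m ≥ 1` and `k` odd it is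
`{(k - 1) / 2 ^ m | (k + 1) / 2 ^ m}`. -/
def ofFrac : ℕ → ℤ → FormalGame
  | 0, k => ofInt k
  | m + 1, k =>
    if Even k then ofFrac m (k / 2)
    else mk (m := 1) (n := 1) (fun _ => ofFrac m ((k - 1) / 2)) (fun _ => ofFrac m ((k + 1) / 2))

/-- The canonical form of a dyadic rational (whose reduced denominator is a power of `2`). -/
def ofDyadic (x : ZHalf) : FormalGame := ofFrac (Nat.log 2 (x : ℚ).den) (x : ℚ).num

/-! ### Thermographs, temperature and cooling -/

/-- `G` is equal to an integer. -/
def IsInt (G : FormalGame) : Prop := ∃ n : ℤ, Equal G (ofInt n)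

/-- The maximum of a finite family (`0` for the empty family; a game that is not equal to an
integer has options for both players). -/
def finMax {m : ℕ} (f : Fin m → ZHalf) : ZHalf :=
  if h : (Finset.univ : Finset (Fin m)).Nonempty then Finset.univ.sup' h f else 0

/-- The minimum of a finite family (`0` for the empty family). -/
def finMin {m : ℕ} (f : Fin m → ZHalf) : ZHalf :=
  if h : (Finset.univ : Finset (Fin m)).Nonempty then Finset.univ.inf' h f else 0

/-- The least `s ∈ ℤ[1/2]` with `f s = g s`. -/
noncomputable def firstMeet (f g : ZHalf → ZHalf) : ZHalf :=
  Classical.epsilon fun s => IsLeast {s | f s = g s} s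

open Classical in
/-- The pair `(λ(G), ρ(G))` of the walls of the thermograph, as functions of `t`. -/
noncomputable def walls : FormalGame → (ZHalf → ZHalf) × (ZHalf → ZHalf)
  | mk L R =>
    if h : IsInt (mk L R) then (fun _ => (h.choose : ZHalf), fun _ => (h.choose : ZHalf))
    else
      let lam : ZHalf → ZHalf := fun t => finMax fun i => (walls (L i)).2 t - t
      let rho : ZHalf → ZHalf := fun t => finMin fun j => (walls (R j)).1 t + t
      let T := firstMeet lam rho
      (fun t => if t ≤ T then lam t else lam T, fun t => if t ≤ T then rho t else lam T)

/-- The left wall `λ_t(G)`. -/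
noncomputable def leftWall (t : ZHalf) (G : FormalGame) : ZHalf := (walls G).1 t

/-- The right wall `ρ_t(G)`. -/
noncomputable def rightWall (t : ZHalf) (G : FormalGame) : ZHalf := (walls G).2 t

/-- The left scaffold: the maximum of `ρ_t(G^L) - t` over the Left options. -/
noncomputable def leftScaffold (t : ZHalf) (G : FormalGame) : ZHalf :=
  finMax fun i => rightWall t (G.left i) - t

/-- The right scaffold: the minimum of `λ_t(G^R) + t` over the Right options. -/
noncomputable def rightScaffold (t : ZHalf) (G : FormalGame) : ZHalf :=
  finMin fun j => leftWall t (G.right j) + t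

/-- For `G` not equal to an integer, the least `t` at which the scaffolds meet. -/
noncomputable def meetTime (G : FormalGame) : ZHalf :=
  firstMeet (fun t => leftScaffold t G) (fun t => rightScaffold t G)

open Classical in
/-- The temperature `t(G)`; it is `-∞` if `G` is equal to an integer. -/
noncomputable def temperature (G : FormalGame) : WithBot ZHalf :=
  if IsInt G then ⊥ else (meetTime G : WithBot ZHalf)

/-- The mast value `x = λ_{t(G)}(G)` of a game that is not equal to an integer. -/
noncomputable def mast (G : FormalGame) : ZHalf := leftWall (meetTime G) G

open Classical in
/-- The game `G_t`, that is, `G` cooled by `t`. -/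
noncomputable def cool (t : ZHalf) : FormalGame → FormalGame
  | mk L R =>
    if h : IsInt (mk L R) then ofInt h.choose
    else if (t : WithBot ZHalf) ≤ temperature (mk L R) then
      mk (fun i => cool t (L i) - ofDyadic t) (fun j => cool t (R j) + ofDyadic t)
    else ofDyadic (mast (mk L R))

/-- The recursion that defines the left wall. -/
theorem leftWall_of_not_isInt (t : ZHalf) (G : FormalGame) (h : ¬ IsInt G) :
    leftWall t G = if (t : WithBot ZHalf) ≤ temperature G then leftScaffold t G else mast G := by
  have key : ∀ s, leftWall s G =
      if s ≤ meetTime G then leftScaffold s G else leftScaffold (meetTime G) G := by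
    intro s
    cases G with
    | mk L R =>
      rw [leftWall, walls, dif_neg h]
      rfl
  simp only [temperature, mast, h, if_false, WithBot.coe_le_coe, key, le_refl, if_true]

/-- The recursion that defines the right wall. -/
theorem rightWall_of_not_isInt (t : ZHalf) (G : FormalGame) (h : ¬ IsInt G) :
    rightWall t G = if (t : WithBot ZHalf) ≤ temperature G then rightScaffold t G else mast G := by
  have key : rightWall t G =
      if t ≤ meetTime G then rightScaffold t G else leftScaffold (meetTime G) G := by
    cases G with
    | mk L R =>
      rw [rightWall, walls, dif_neg h]
      rfl
  have hm : mast G = leftScaffold (meetTime G) G := by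
    rw [mast, leftWall_of_not_isInt _ _ h]
    simp [temperature, h]
  simp only [temperature, h, if_false, WithBot.coe_le_coe, key, hm]

/-- The recursion that defines cooling. -/
theorem cool_of_not_isInt (t : ZHalf) (G : FormalGame) (h : ¬ IsInt G) :
    cool t G = if (t : WithBot ZHalf) ≤ temperature G then
      mk (fun i => cool t (G.left i) - ofDyadic t) (fun j => cool t (G.right j) + ofDyadic t)
    else ofDyadic (mast G) := by
  cases G with
  | mk L R =>
    rw [cool, dif_neg h]
    rfl

end FormalGame

/-! Clauses 1 and 2 are proved together for all `t > -1` (`coolValue_order`), by induction on the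
sum of the birthdays. Were nothing ever frozen, cooling would only tax each move by `t` and the
induction would be formal: `H ≤ G` says that `G ≰ H^L` and `G^R ≰ H`, which clause 2 turns into the
inequalities defining `H_t ≤ G_t`; and `G ≰ H` says that `H ≤ G^L` or `H^R ≤ G`, which clause 1
turns into a good move in the taxed games. The work lies in the freezing, where a game tree is
replaced by a number.

Three facts control it. First (`hasThermograph`), the walls are monotone and `1`-Lipschitz with
dyadic corners, so scaffolds do meet in `ℤ[1/2]`; at `-1` the walls are the integers that round `G`
up and down, so a non-integer freezes strictly after `-1`, and an integer behaves as if frozen at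
`-1`. Second (`hasStops`), the walls at `t` are the stops of `G_t`, whence number avoidance: in
comparing an unfrozen cooled game with a number, moves in the number can be ignored. Third, stops
decide comparisons with numbers only away from equality, but a bound on the walls at some `s < t`
gives an exact bound on `G_t` (`coolValue_bounds_of_lt_above` and its mirror image): the extra tax
`t - s` removes infinitesimals.

For clause 1, if both games are frozen at `t`, one goes back to the later of the two freezing
temperatures, where the walls already have their final values. For clause 2, one goes back to the
freezing temperature of the game containing the good move, or to `-1` for an integer, and carries
the resulting wall inequality forward to `t` by the third fact. -/

namespace FormalGame

/-! ### The ordered group of game values -/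

theorem add_def (G H : FormalGame) :
    G + H = mk (Fin.append (fun i => G.left i + H) (fun i => G + H.left i))
      (Fin.append (fun j => G.right j + H) (fun j => G + H.right j)) := by
  change add G H = _
  rw [add]
  rfl

theorem forall_append {α : Type*} {m n : ℕ} {a : Fin m → α} {b : Fin n → α} {P : α → Prop} :
    (∀ i, P (Fin.append a b i)) ↔ (∀ i, P (a i)) ∧ ∀ i, P (b i) := by
  refine ⟨fun h => ⟨fun i => ?_, fun i => ?_⟩, fun h i => ?_⟩
  · simpa using h (Fin.castAdd n i)
  · simpa using h (Fin.natAdd m i)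
  · refine Fin.addCases (fun i => ?_) (fun i => ?_) i
    · simpa using h.1 i
    · simpa using h.2 i

theorem forall_left_add {G H : FormalGame} {P : FormalGame → Prop} :
    (∀ i, P ((G + H).left i)) ↔ (∀ i, P (G.left i + H)) ∧ ∀ i, P (G + H.left i) := by
  rw [← forall_append (a := fun i => G.left i + H), add_def]
  rfl

theorem forall_right_add {G H : FormalGame} {P : FormalGame → Prop} :
    (∀ j, P ((G + H).right j)) ↔ (∀ j, P (G.right j + H)) ∧ ∀ j, P (G + H.right j) := by
  rw [← forall_append (a := fun i => G.right i + H), add_def]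
  rfl

theorem forall_left_neg {G : FormalGame} {P : FormalGame → Prop} :
    (∀ i, P ((-G).left i)) ↔ ∀ j, P (-G.right j) := by
  cases G; exact Iff.rfl

theorem forall_right_neg {G : FormalGame} {P : FormalGame → Prop} :
    (∀ j, P ((-G).right j)) ↔ ∀ i, P (-G.left i) := by
  cases G; exact Iff.rfl

/-- The two directions feed each other on smaller games: a move in the options of `G` or `H` is
cancelled, while a move in `K` is answered by the same move in the other copy of `K`. -/
theorem add_le_add_iff (G H K : FormalGame) : G + K ≤ H + K ↔ G ≤ H := by
  constructor
  · intro h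
    rw [le_def] at h ⊢
    refine ⟨fun i hi => ?_, fun j hj => ?_⟩
    · exact (forall_left_add (P := fun X => ¬ H + K ≤ X).1 h.1).1 i
        ((add_le_add_iff H (G.left i) K).2 hi)
    · exact (forall_right_add (P := fun X => ¬ X ≤ G + K).1 h.2).1 j
        ((add_le_add_iff (H.right j) G K).2 hj)
  · intro h
    have h' := (le_def _ _).1 h
    rw [le_def]
    refine ⟨forall_left_add (P := fun X => ¬ H + K ≤ X).2 ⟨fun i hi => ?_, fun i hi => ?_⟩,
      forall_right_add (P := fun X => ¬ X ≤ G + K).2 ⟨fun j hj => ?_, fun j hj => ?_⟩⟩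
    · exact h'.1 i ((add_le_add_iff H (G.left i) K).1 hi)
    · exact (forall_left_add (P := fun X => ¬ G + K.left i ≤ X).1 ((le_def _ _).1 hi).1).2 i
        ((add_le_add_iff G H (K.left i)).2 h)
    · exact h'.2 j ((add_le_add_iff (H.right j) G K).1 hj)
    · exact (forall_right_add (P := fun X => ¬ X ≤ H + K.right j).1 ((le_def _ _).1 hj).2).2 j
        ((add_le_add_iff G H (K.right j)).2 h)
termination_by G.birthday + H.birthday + K.birthday
decreasing_by
  all_goals first
    | (have := birthday_left G i; omega)
    | (have := birthday_right H j; omega)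
    | (have := birthday_left K i; omega)
    | (have := birthday_right K j; omega)

theorem neg_le_neg_iff (G H : FormalGame) : -G ≤ -H ↔ H ≤ G := by
  rw [le_def, forall_left_neg (P := fun X => ¬ -H ≤ X), forall_right_neg (P := fun X => ¬ X ≤ -G),
    le_def H G, and_comm]
  refine and_congr (forall_congr' fun i => not_congr ?_) (forall_congr' fun j => not_congr ?_)
  · exact neg_le_neg_iff (H.left i) G
  · exact neg_le_neg_iff H (G.right j)
termination_by G.birthday + H.birthday
decreasing_by
  · have := birthday_left H i; omega
  · have := birthday_right G j; omega

theorem not_le_left (G : FormalGame) (i) : ¬ G ≤ G.left i :=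
  ((le_def _ _).1 (le_refl G)).1 i

theorem not_right_le (G : FormalGame) (j) : ¬ G.right j ≤ G :=
  ((le_def _ _).1 (le_refl G)).2 j

theorem not_add_le_left_add (G H : FormalGame) (i) : ¬ G + H ≤ G.left i + H :=
  (forall_left_add (P := fun X => ¬ G + H ≤ X).1 (not_le_left _)).1 i

theorem not_add_le_add_left (G H : FormalGame) (i) : ¬ G + H ≤ G + H.left i :=
  (forall_left_add (P := fun X => ¬ G + H ≤ X).1 (not_le_left _)).2 i

theorem not_right_add_le_add (G H : FormalGame) (j) : ¬ G.right j + H ≤ G + H :=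
  (forall_right_add (P := fun X => ¬ X ≤ G + H).1 (not_right_le _)).1 j

theorem not_add_right_le_add (G H : FormalGame) (j) : ¬ G + H.right j ≤ G + H :=
  (forall_right_add (P := fun X => ¬ X ≤ G + H).1 (not_right_le _)).2 j

theorem add_comm_le (G H : FormalGame) : G + H ≤ H + G := by
  rw [le_def]
  refine ⟨forall_left_add (P := fun X => ¬ H + G ≤ X).2 ⟨fun i h => ?_, fun i h => ?_⟩,
      forall_right_add (P := fun X => ¬ X ≤ G + H).2 ⟨fun j h => ?_, fun j h => ?_⟩⟩
  · exact not_add_le_add_left H G i (h.trans (add_comm_le (G.left i) H))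
  · exact not_add_le_left_add H G i (h.trans (add_comm_le G (H.left i)))
  · exact not_add_right_le_add G H j ((add_comm_le G (H.right j)).trans h)
  · exact not_right_add_le_add G H j ((add_comm_le (G.right j) H).trans h)
termination_by G.birthday + H.birthday
decreasing_by
  all_goals first
    | (have := birthday_left G i; omega)
    | (have := birthday_left H i; omega)
    | (have := birthday_right G j; omega)
    | (have := birthday_right H j; omega)

theorem add_assoc_le (G H K : FormalGame) :
    G + H + K ≤ G + (H + K) ∧ G + (H + K) ≤ G + H + K := by
  have hl : ∀ i, G.left i + H + K ≤ G.left i + (H + K) ∧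
      G.left i + (H + K) ≤ G.left i + H + K := fun i => add_assoc_le (G.left i) H K
  have hl₂ : ∀ i, G + H.left i + K ≤ G + (H.left i + K) ∧
      G + (H.left i + K) ≤ G + H.left i + K := fun i => add_assoc_le G (H.left i) K
  have hl₃ : ∀ i, G + H + K.left i ≤ G + (H + K.left i) ∧
      G + (H + K.left i) ≤ G + H + K.left i := fun i => add_assoc_le G H (K.left i)
  have hr : ∀ j, G.right j + H + K ≤ G.right j + (H + K) ∧
      G.right j + (H + K) ≤ G.right j + H + K := fun j => add_assoc_le (G.right j) H K
  have hr₂ : ∀ j, G + H.right j + K ≤ G + (H.right j + K) ∧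
      G + (H.right j + K) ≤ G + H.right j + K := fun j => add_assoc_le G (H.right j) K
  have hr₃ : ∀ j, G + H + K.right j ≤ G + (H + K.right j) ∧
      G + (H + K.right j) ≤ G + H + K.right j := fun j => add_assoc_le G H (K.right j)
  have left₁ : ∀ X, (∀ i, ¬ X ≤ (G + (H + K)).left i) ↔ (∀ i, ¬ X ≤ G.left i + (H + K)) ∧
      (∀ i, ¬ X ≤ G + (H.left i + K)) ∧ ∀ i, ¬ X ≤ G + (H + K.left i) := fun X => by
    rw [forall_left_add (P := fun Y => ¬ X ≤ Y), forall_left_add (P := fun Y => ¬ X ≤ G + Y)]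
  have left₂ : ∀ X, (∀ i, ¬ X ≤ (G + H + K).left i) ↔ ((∀ i, ¬ X ≤ G.left i + H + K) ∧
      (∀ i, ¬ X ≤ G + H.left i + K)) ∧ ∀ i, ¬ X ≤ G + H + K.left i := fun X => by
    rw [forall_left_add (P := fun Y => ¬ X ≤ Y), forall_left_add (P := fun Y => ¬ X ≤ Y + K)]
  have right₁ : ∀ X, (∀ i, ¬ (G + (H + K)).right i ≤ X) ↔ (∀ i, ¬ G.right i + (H + K) ≤ X) ∧
      (∀ i, ¬ G + (H.right i + K) ≤ X) ∧ ∀ i, ¬ G + (H + K.right i) ≤ X := fun X => by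
    rw [forall_right_add (P := fun Y => ¬ Y ≤ X), forall_right_add (P := fun Y => ¬ G + Y ≤ X)]
  have right₂ : ∀ X, (∀ i, ¬ (G + H + K).right i ≤ X) ↔ ((∀ i, ¬ G.right i + H + K ≤ X) ∧
      (∀ i, ¬ G + H.right i + K ≤ X)) ∧ ∀ i, ¬ G + H + K.right i ≤ X := fun X => by
    rw [forall_right_add (P := fun Y => ¬ Y ≤ X), forall_right_add (P := fun Y => ¬ Y + K ≤ X)]
  obtain ⟨a₁, a₂, a₃⟩ := (left₁ _).1 (not_le_left _)
  obtain ⟨⟨b₁, b₂⟩, b₃⟩ := (left₂ _).1 (not_le_left _)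
  obtain ⟨c₁, c₂, c₃⟩ := (right₁ _).1 (not_right_le _)
  obtain ⟨⟨d₁, d₂⟩, d₃⟩ := (right₂ _).1 (not_right_le _)
  constructor
  · rw [le_def, left₂, right₁]
    exact ⟨⟨⟨fun i h => a₁ i (h.trans (hl i).1), fun i h => a₂ i (h.trans (hl₂ i).1)⟩,
      fun i h => a₃ i (h.trans (hl₃ i).1)⟩, fun j h => d₁ j ((hr j).1.trans h),
      fun j h => d₂ j ((hr₂ j).1.trans h), fun j h => d₃ j ((hr₃ j).1.trans h)⟩
  · rw [le_def, left₁, right₂]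
    exact ⟨⟨fun i h => b₁ i (h.trans (hl i).2), fun i h => b₂ i (h.trans (hl₂ i).2),
      fun i h => b₃ i (h.trans (hl₃ i).2)⟩, ⟨fun j h => c₁ j ((hr j).2.trans h),
      fun j h => c₂ j ((hr₂ j).2.trans h)⟩, fun j h => c₃ j ((hr₃ j).2.trans h)⟩
termination_by G.birthday + H.birthday + K.birthday
decreasing_by
  all_goals first
    | (have := birthday_left G i; omega)
    | (have := birthday_left H i; omega)
    | (have := birthday_left K i; omega)
    | (have := birthday_right G j; omega)
    | (have := birthday_right H j; omega)
    | (have := birthday_right K j; omega)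

theorem add_zero_le (G : FormalGame) : G + 0 ≤ G ∧ G ≤ G + 0 := by
  have hl : ∀ i, G.left i + 0 ≤ G.left i ∧ G.left i ≤ G.left i + 0 :=
    fun i => add_zero_le (G.left i)
  have hr : ∀ j, G.right j + 0 ≤ G.right j ∧ G.right j ≤ G.right j + 0 :=
    fun j => add_zero_le (G.right j)
  constructor
  · rw [le_def]
    exact ⟨forall_left_add (P := fun X => ¬ G ≤ X).2
      ⟨fun i h => not_le_left G i (h.trans (hl i).1), fun i => i.elim0⟩,
      fun j h => not_right_add_le_add G 0 j ((hr j).1.trans h)⟩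
  · rw [le_def]
    exact ⟨fun i h => not_add_le_left_add G 0 i (h.trans (hl i).2),
      forall_right_add (P := fun X => ¬ X ≤ G).2
      ⟨fun j h => not_right_le G j ((hr j).2.trans h), fun i => i.elim0⟩⟩
termination_by G.birthday
decreasing_by
  · exact birthday_left G i
  · exact birthday_right G j

/-- The second player copies each move in the other component. -/
theorem neg_add_self_le (G : FormalGame) : -G + G ≤ 0 ∧ 0 ≤ -G + G := by
  have hl : ∀ i, -G.left i + G.left i ≤ 0 ∧ 0 ≤ -G.left i + G.left i :=
    fun i => neg_add_self_le (G.left i)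
  have hr : ∀ j, -G.right j + G.right j ≤ 0 ∧ 0 ≤ -G.right j + G.right j :=
    fun j => neg_add_self_le (G.right j)
  constructor
  · rw [le_def, forall_left_add (P := fun X => ¬ 0 ≤ X),
      forall_left_neg (P := fun X => ¬ 0 ≤ X + G)]
    exact ⟨⟨fun j h => not_add_right_le_add _ _ j ((hr j).1.trans h), fun i h =>
      (forall_right_neg (P := fun X => ¬ X + G.left i ≤ -G + G.left i)).1
        (not_right_add_le_add _ _) i ((hl i).1.trans h)⟩, fun j => j.elim0⟩
  · rw [le_def, forall_right_add (P := fun X => ¬ X ≤ 0),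
      forall_right_neg (P := fun X => ¬ X + G ≤ 0)]
    exact ⟨fun j => j.elim0, ⟨fun i h => not_add_le_add_left _ _ i (h.trans (hl i).2), fun j h =>
      (forall_left_neg (P := fun X => ¬ -G + G.right j ≤ X + G.right j)).1
        (not_add_le_left_add _ _) j (h.trans (hr j).2)⟩⟩
termination_by G.birthday
decreasing_by
  · exact birthday_left G i
  · exact birthday_right G j

/-! ### Passage from formal games to the group of values -/

theorem value_le_value {G H : FormalGame} : value G ≤ value H ↔ G ≤ H := Iff.rfl

theorem value_eq_value {G H : FormalGame} : value G = value H ↔ Equal G H := by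
  rw [le_antisymm_iff]; rfl

theorem add_le_add_left_iff (G H K : FormalGame) : K + G ≤ K + H ↔ G ≤ H :=
  ⟨fun h => (add_le_add_iff G H K).1 ((add_comm_le G K).trans (h.trans (add_comm_le K H))),
    fun h => (add_comm_le K G).trans (((add_le_add_iff G H K).2 h).trans (add_comm_le H K))⟩

instance : Zero Value := ⟨value 0⟩

instance : Add Value := ⟨Quotient.map₂ (· + ·) fun G G' h H H' h' =>
  ⟨((add_le_add_iff G G' H).2 h.1).trans ((add_le_add_left_iff H H' G').2 h'.1),
    ((add_le_add_iff G' G H').2 h.2).trans ((add_le_add_left_iff H' H G).2 h'.2)⟩⟩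

instance : Neg Value := ⟨Quotient.map (- ·) fun G G' h =>
  ⟨(neg_le_neg_iff G G').2 h.2, (neg_le_neg_iff G' G).2 h.1⟩⟩

theorem value_add (G H : FormalGame) : value (G + H) = value G + value H := rfl

theorem value_neg (G : FormalGame) : value (-G) = -value G := rfl

theorem value_surjective : Function.Surjective value := Quotient.mk_surjective

instance : AddCommGroup Value where
  add_assoc a b c := by
    obtain ⟨G, rfl⟩ := value_surjective a
    obtain ⟨H, rfl⟩ := value_surjective b
    obtain ⟨K, rfl⟩ := value_surjective c
    exact value_eq_value.2 (add_assoc_le G H K)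
  zero_add a := by
    obtain ⟨G, rfl⟩ := value_surjective a
    exact value_eq_value.2 ⟨(add_comm_le 0 G).trans (add_zero_le G).1,
      (add_zero_le G).2.trans (add_comm_le G 0)⟩
  add_zero a := by
    obtain ⟨G, rfl⟩ := value_surjective a
    exact value_eq_value.2 (add_zero_le G)
  neg_add_cancel a := by
    obtain ⟨G, rfl⟩ := value_surjective a
    exact value_eq_value.2 (neg_add_self_le G)
  add_comm a b := by
    obtain ⟨G, rfl⟩ := value_surjective a
    obtain ⟨H, rfl⟩ := value_surjective b
    exact value_eq_value.2 ⟨add_comm_le G H, add_comm_le H G⟩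
  nsmul := nsmulRec
  zsmul := zsmulRec

instance : IsOrderedAddMonoid Value where
  add_le_add_left a b h c := by
    obtain ⟨G, rfl⟩ := value_surjective a
    obtain ⟨H, rfl⟩ := value_surjective b
    obtain ⟨K, rfl⟩ := value_surjective c
    exact (add_le_add_iff G H K).2 h

theorem value_sub (G H : FormalGame) : value (G - H) = value G - value H := by
  rw [sub_eq_add_neg]; rfl

theorem greaterOrFuzzy_iff {G H : FormalGame} : GreaterOrFuzzy G H ↔ ¬ G ≤ H := by
  rw [GreaterOrFuzzy, lt_iff_le_not_ge]
  tauto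

/-! ### Numbers -/

theorem neg_ofNat_zero : -ofNat 0 = ofNat 0 := by
  change neg (mk Fin.elim0 Fin.elim0) = mk Fin.elim0 Fin.elim0
  rw [neg]
  congr 1 <;> exact funext fun i => i.elim0

theorem ofInt_neg_natCast (n : ℕ) : ofInt (-n) = -ofNat n := by
  cases n with
  | zero => exact neg_ofNat_zero.symm
  | succ n => rfl

theorem ofInt_left (k : ℤ) (i) : 0 < k ∧ (ofInt k).left i = ofInt (k - 1) := by
  obtain ⟨n, rfl | rfl⟩ := k.eq_nat_or_neg
  · cases n with
    | zero => exact i.elim0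
    | succ n =>
      refine ⟨by positivity, ?_⟩
      have : ((n + 1 : ℕ) : ℤ) - 1 = n := by push_cast; ring
      rw [this]
      rfl
  · rw [ofInt_neg_natCast] at i
    exfalso
    cases n with
    | zero => exact i.elim0
    | succ n => exact i.elim0

theorem ofInt_right (k : ℤ) (j) : k < 0 ∧ (ofInt k).right j = ofInt (k + 1) := by
  obtain ⟨n, rfl | rfl⟩ := k.eq_nat_or_neg
  · cases n with
    | zero => exact j.elim0
    | succ n => exact j.elim0
  · cases n with
    | zero => exact j.elim0
    | succ n =>
      refine ⟨by rw [neg_lt_zero]; positivity, ?_⟩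
      have : -((n + 1 : ℕ) : ℤ) + 1 = -n := by push_cast; ring
      rw [this, ofInt_neg_natCast n]
      rfl

theorem exists_ofInt_left {k : ℤ} (hk : 0 < k) : ∃ i, (ofInt k).left i = ofInt (k - 1) := by
  obtain ⟨n, hn⟩ := Int.exists_add_of_le hk
  obtain rfl : k = ((n + 1 : ℕ) : ℤ) := by push_cast; linarith
  let i : Fin (ofInt ((n + 1 : ℕ) : ℤ)).numLeft := (0 : Fin 1)
  exact ⟨i, (ofInt_left _ i).2⟩

theorem exists_ofInt_right {k : ℤ} (hk : k < 0) : ∃ j, (ofInt k).right j = ofInt (k + 1) := by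
  obtain ⟨n, hn⟩ := Int.exists_add_of_le hk
  obtain rfl : k = -((n + 1 : ℕ) : ℤ) := by push_cast; linarith
  let j : Fin (ofInt (-((n + 1 : ℕ) : ℤ))).numRight := (0 : Fin 1)
  exact ⟨j, (ofInt_right _ j).2⟩

theorem ofFrac_zero (k : ℤ) : ofFrac 0 k = ofInt k := by rw [ofFrac]

theorem ofFrac_succ_two_mul (m : ℕ) (k : ℤ) : ofFrac (m + 1) (2 * k) = ofFrac m k := by
  rw [ofFrac, if_pos (even_two_mul k)]
  congr 1
  omega

theorem ofFrac_succ_odd (m : ℕ) {k : ℤ} (hk : Odd k) : ofFrac (m + 1) k =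
    mk (m := 1) (n := 1) (fun _ => ofFrac (m + 1) (k - 1)) (fun _ => ofFrac (m + 1) (k + 1)) := by
  obtain ⟨l, rfl⟩ := hk
  rw [ofFrac, if_neg (by simp), show 2 * l + 1 - 1 = 2 * l by ring,
    show 2 * l + 1 + 1 = 2 * (l + 1) by ring, ofFrac_succ_two_mul, ofFrac_succ_two_mul]
  congr 1 <;> funext _ <;> congr 1 <;> omega

theorem ofFrac_left (m : ℕ) (k : ℤ) (i) : ∃ k' < k, (ofFrac m k).left i = ofFrac m k' := by
  induction m generalizing k with
  | zero =>
    revert i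
    simp only [ofFrac_zero]
    intro i
    exact ⟨k - 1, by omega, (ofInt_left k i).2⟩
  | succ m ih =>
    rcases Int.even_or_odd' k with ⟨l, rfl | rfl⟩
    · revert i
      rw [ofFrac_succ_two_mul]
      intro i
      obtain ⟨k', hk', h⟩ := ih l i
      exact ⟨2 * k', by omega, by rw [h, ofFrac_succ_two_mul]⟩
    · revert i
      rw [ofFrac_succ_odd m (odd_two_mul_add_one l)]
      exact fun i => ⟨2 * l + 1 - 1, by omega, rfl⟩

theorem ofFrac_right (m : ℕ) (k : ℤ) (j) : ∃ k' > k, (ofFrac m k).right j = ofFrac m k' := by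
  induction m generalizing k with
  | zero =>
    revert j
    simp only [ofFrac_zero]
    intro j
    exact ⟨k + 1, by omega, (ofInt_right k j).2⟩
  | succ m ih =>
    rcases Int.even_or_odd' k with ⟨l, rfl | rfl⟩
    · revert j
      rw [ofFrac_succ_two_mul]
      intro j
      obtain ⟨k', hk', h⟩ := ih l j
      exact ⟨2 * k', by omega, by rw [h, ofFrac_succ_two_mul]⟩
    · revert j
      rw [ofFrac_succ_odd m (odd_two_mul_add_one l)]
      exact fun j => ⟨2 * l + 1 + 1, by omega, rfl⟩

theorem exists_ofFrac_left_of_odd (m : ℕ) {k : ℤ} (hk : Odd k) :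
    ∃ i, (ofFrac (m + 1) k).left i = ofFrac (m + 1) (k - 1) := by
  rw [ofFrac_succ_odd m hk]
  exact ⟨(0 : Fin 1), rfl⟩

theorem exists_ofFrac_right_of_odd (m : ℕ) {k : ℤ} (hk : Odd k) :
    ∃ j, (ofFrac (m + 1) k).right j = ofFrac (m + 1) (k + 1) := by
  rw [ofFrac_succ_odd m hk]
  exact ⟨(0 : Fin 1), rfl⟩

/-- Options of a number lie strictly on the correct sides of it, so weak inequalities are automatic.
Strictness needs a move of one unit `1 / 2 ^ m` across the gap, from `l` down or from `k` up; `hm`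
provides it or settles the pair at a coarser level. -/
theorem ofFrac_le_ofFrac_aux (m : ℕ) (hm : ∀ k l, k < l → ¬ ofFrac m l ≤ ofFrac m k ∨
      (∃ i, (ofFrac m l).left i = ofFrac m (l - 1)) ∨
      ∃ j, (ofFrac m k).right j = ofFrac m (k + 1)) (k l : ℤ) :
    (k ≤ l → ofFrac m k ≤ ofFrac m l) ∧ (k < l → ¬ ofFrac m l ≤ ofFrac m k) := by
  induction hN : (ofFrac m k).birthday + (ofFrac m l).birthday using Nat.strong_induction_on
    generalizing k l with
  | _ N ih =>
    subst hN
    refine ⟨fun hkl => ?_, fun hkl => ?_⟩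
    · rw [le_def]
      refine ⟨fun i => ?_, fun j => ?_⟩
      · have hb := birthday_left _ i
        obtain ⟨k', hk', h⟩ := ofFrac_left m k i
        rw [h] at hb ⊢
        exact (ih _ (by omega) k' l rfl).2 (by omega)
      · have hb := birthday_right _ j
        obtain ⟨l', hl', h⟩ := ofFrac_right m l j
        rw [h] at hb ⊢
        exact (ih _ (by omega) k l' rfl).2 (by omega)
    · rcases hm k l hkl with h | ⟨i, h⟩ | ⟨j, h⟩
      · exact h
      · intro hle
        have hb := birthday_left _ i
        rw [h] at hb
        exact ((le_def _ _).1 hle).1 i (h ▸ (ih _ (by omega) k (l - 1) rfl).1 (by omega))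
      · intro hle
        have hb := birthday_right _ j
        rw [h] at hb
        exact ((le_def _ _).1 hle).2 j (h ▸ (ih _ (by omega) (k + 1) l rfl).1 (by omega))

theorem ofFrac_le_ofFrac (m : ℕ) (k l : ℤ) : ofFrac m k ≤ ofFrac m l ↔ k ≤ l := by
  suffices h : ∀ k l, k < l → ¬ ofFrac m l ≤ ofFrac m k ∨
      (∃ i, (ofFrac m l).left i = ofFrac m (l - 1)) ∨
      ∃ j, (ofFrac m k).right j = ofFrac m (k + 1) by
    refine ⟨fun hle => ?_, (ofFrac_le_ofFrac_aux m h k l).1⟩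
    by_contra! hlt
    exact (ofFrac_le_ofFrac_aux m h l k).2 hlt hle
  induction m with
  | zero =>
    intro k l hkl
    simp only [ofFrac_zero]
    rcases lt_or_ge 0 l with hl | hl
    · exact Or.inr (Or.inl (exists_ofInt_left hl))
    · exact Or.inr (Or.inr (exists_ofInt_right (by omega)))
  | succ m ih =>
    intro k l hkl
    rcases Int.even_or_odd l with hl | hl
    · rcases Int.even_or_odd k with hk | hk
      · obtain ⟨k, rfl⟩ := even_iff_two_dvd.1 hk
        obtain ⟨l, rfl⟩ := even_iff_two_dvd.1 hl
        rw [ofFrac_succ_two_mul, ofFrac_succ_two_mul]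
        exact Or.inl ((ofFrac_le_ofFrac_aux m ih k l).2 (by omega))
      · exact Or.inr (Or.inr (exists_ofFrac_right_of_odd m hk))
    · exact Or.inr (Or.inl (exists_ofFrac_left_of_odd m hl))

theorem ofInt_le_ofInt {k l : ℤ} : ofInt k ≤ ofInt l ↔ k ≤ l := by
  rw [← ofFrac_zero, ← ofFrac_zero, ofFrac_le_ofFrac]

/-- A move in `k + l` must be matched by a move in a summand that is at least as good; a move by a
single unit suffices, and `hm` provides one. -/
theorem value_ofFrac_add_aux (m : ℕ) (hm : ∀ k l,
      value (ofFrac m k) + value (ofFrac m l) = value (ofFrac m (k + l)) ∨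
      ((∀ _ : Fin (ofFrac m (k + l)).numLeft,
        (∃ i, (ofFrac m k).left i = ofFrac m (k - 1)) ∨
        ∃ i, (ofFrac m l).left i = ofFrac m (l - 1)) ∧
      ∀ _ : Fin (ofFrac m (k + l)).numRight,
        (∃ j, (ofFrac m k).right j = ofFrac m (k + 1)) ∨
        ∃ j, (ofFrac m l).right j = ofFrac m (l + 1))) (k l : ℤ) :
    value (ofFrac m k) + value (ofFrac m l) = value (ofFrac m (k + l)) := by
  induction hN : (ofFrac m k).birthday + (ofFrac m l).birthday using Nat.strong_induction_on
    generalizing k l with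
  | _ N ih =>
    subst hN
    rcases hm k l with h | ⟨hl, hr⟩
    · exact h
    have left₁ : ∀ i k', (ofFrac m k).left i = ofFrac m k' →
        value (ofFrac m k') + value (ofFrac m l) = value (ofFrac m (k' + l)) := by
      intro i k' h
      have hb := birthday_left _ i
      rw [h] at hb
      exact ih _ (by omega) _ _ rfl
    have left₂ : ∀ i l', (ofFrac m l).left i = ofFrac m l' →
        value (ofFrac m k) + value (ofFrac m l') = value (ofFrac m (k + l')) := by
      intro i k' h
      have hb := birthday_left _ i
      rw [h] at hb
      exact ih _ (by omega) _ _ rfl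
    have right₁ : ∀ i k', (ofFrac m k).right i = ofFrac m k' →
        value (ofFrac m k') + value (ofFrac m l) = value (ofFrac m (k' + l)) := by
      intro i k' h
      have hb := birthday_right _ i
      rw [h] at hb
      exact ih _ (by omega) _ _ rfl
    have right₂ : ∀ i l', (ofFrac m l).right i = ofFrac m l' →
        value (ofFrac m k) + value (ofFrac m l') = value (ofFrac m (k + l')) := by
      intro i k' h
      have hb := birthday_right _ i
      rw [h] at hb
      exact ih _ (by omega) _ _ rfl
    rw [← value_add]
    apply le_antisymm
    · rw [value_le_value, le_def, forall_left_add (P := fun X => ¬ ofFrac m (k + l) ≤ X)]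
      refine ⟨⟨fun i => ?_, fun i => ?_⟩, fun j hle => ?_⟩
      · obtain ⟨k', hk', h⟩ := ofFrac_left m k i
        rw [h, ← value_le_value, value_add, left₁ i k' h, value_le_value, ofFrac_le_ofFrac]
        omega
      · obtain ⟨k', hk', h⟩ := ofFrac_left m l i
        rw [h, ← value_le_value, value_add, left₂ i k' h, value_le_value, ofFrac_le_ofFrac]
        omega
      · obtain ⟨r, hr', h⟩ := ofFrac_right m (k + l) j
        rw [h] at hle
        rcases hr j with ⟨j', h'⟩ | ⟨j', h'⟩
        · refine not_right_add_le_add (ofFrac m k) (ofFrac m l) j' (le_trans ?_ hle)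
          rw [h', ← value_le_value, value_add, right₁ _ _ h', value_le_value, ofFrac_le_ofFrac]
          omega
        · refine not_add_right_le_add (ofFrac m k) (ofFrac m l) j' (le_trans ?_ hle)
          rw [h', ← value_le_value, value_add, right₂ _ _ h', value_le_value, ofFrac_le_ofFrac]
          omega
    · rw [value_le_value, le_def, forall_right_add (P := fun X => ¬ X ≤ ofFrac m (k + l))]
      refine ⟨fun j hle => ?_, ⟨fun i => ?_, fun i => ?_⟩⟩
      · obtain ⟨r, hr', h⟩ := ofFrac_left m (k + l) j
        rw [h] at hle
        rcases hl j with ⟨j', h'⟩ | ⟨j', h'⟩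
        · refine not_add_le_left_add (ofFrac m k) (ofFrac m l) j' (hle.trans ?_)
          rw [h', ← value_le_value, value_add, left₁ _ _ h', value_le_value, ofFrac_le_ofFrac]
          omega
        · refine not_add_le_add_left (ofFrac m k) (ofFrac m l) j' (hle.trans ?_)
          rw [h', ← value_le_value, value_add, left₂ _ _ h', value_le_value, ofFrac_le_ofFrac]
          omega
      · obtain ⟨k', hk', h⟩ := ofFrac_right m k i
        rw [h, ← value_le_value, value_add, right₁ i k' h, value_le_value, ofFrac_le_ofFrac]
        omega
      · obtain ⟨k', hk', h⟩ := ofFrac_right m l i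
        rw [h, ← value_le_value, value_add, right₂ i k' h, value_le_value, ofFrac_le_ofFrac]
        omega

theorem value_ofFrac_add (m : ℕ) (k l : ℤ) :
    value (ofFrac m k) + value (ofFrac m l) = value (ofFrac m (k + l)) := by
  induction m generalizing k l with
  | zero =>
    refine value_ofFrac_add_aux 0 (fun k l => Or.inr ⟨fun i => ?_, fun j => ?_⟩) k l
    · simp only [ofFrac_zero] at i ⊢
      have h := (ofInt_left _ i).1
      rcases lt_or_ge 0 k with hk | hk
      · exact Or.inl (exists_ofInt_left hk)
      · exact Or.inr (exists_ofInt_left (by omega))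
    · simp only [ofFrac_zero] at j ⊢
      have h := (ofInt_right _ j).1
      rcases lt_or_ge k 0 with hk | hk
      · exact Or.inl (exists_ofInt_right hk)
      · exact Or.inr (exists_ofInt_right (by omega))
  | succ m ih =>
    refine value_ofFrac_add_aux (m + 1) (fun k l => ?_) k l
    rcases Int.even_or_odd k with hk | hk
    · rcases Int.even_or_odd l with hl | hl
      · obtain ⟨k, rfl⟩ := even_iff_two_dvd.1 hk
        obtain ⟨l, rfl⟩ := even_iff_two_dvd.1 hl
        rw [← mul_add, ofFrac_succ_two_mul, ofFrac_succ_two_mul, ofFrac_succ_two_mul]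
        exact Or.inl (ih k l)
      · exact Or.inr ⟨fun _ => Or.inr (exists_ofFrac_left_of_odd m hl),
          fun _ => Or.inr (exists_ofFrac_right_of_odd m hl)⟩
    · exact Or.inr ⟨fun _ => Or.inl (exists_ofFrac_left_of_odd m hk),
          fun _ => Or.inl (exists_ofFrac_right_of_odd m hk)⟩

/-- The representation need not be reduced: factors of `2` cancel until the numerator is odd or the
denominator is `1`. Two dyadics can thus be treated over a common denominator. -/
theorem ofDyadic_eq_ofFrac {x : ZHalf} {m : ℕ} {k : ℤ} (h : (x : ℚ) = k / 2 ^ m) :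
    ofDyadic x = ofFrac m k := by
  induction m generalizing k with
  | zero =>
    have h' : (x : ℚ) = (k : ℚ) := by simpa using h
    rw [ofDyadic, h']
    simp
  | succ m ih =>
    rcases Int.even_or_odd k with hk | hk
    · obtain ⟨k, rfl⟩ := even_iff_two_dvd.1 hk
      rw [ofFrac_succ_two_mul]
      apply ih
      rw [h, pow_succ]
      push_cast
      field_simp
    · have hc : Nat.Coprime k.natAbs ((2 : ℤ) ^ (m + 1)).natAbs := by
        rw [Int.natAbs_pow]
        exact Nat.Coprime.pow_right _ (Nat.coprime_two_right.2 (Int.natAbs_odd.2 hk))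
      have h' : (x : ℚ) = (k : ℚ) / ((2 ^ (m + 1) : ℤ) : ℚ) := by rw [h]; push_cast; rfl
      have hn := Rat.num_div_eq_of_coprime (by positivity) hc
      have hd := Rat.den_div_eq_of_coprime (by positivity) hc
      rw [← h'] at hn hd
      have hd' : (x : ℚ).den = 2 ^ (m + 1) := by exact_mod_cast hd
      rw [ofDyadic, hn, hd', Nat.log_pow (by norm_num)]

theorem exists_common_frac (x y : ZHalf) :
    ∃ (m : ℕ) (k l : ℤ), (x : ℚ) = k / 2 ^ m ∧ (y : ℚ) = l / 2 ^ m := by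
  obtain ⟨k, m, hx⟩ := x.2
  obtain ⟨l, n, hy⟩ := y.2
  refine ⟨m + n, k * 2 ^ n, l * 2 ^ m, ?_, ?_⟩
  · rw [hx, pow_add]; push_cast; field_simp
  · rw [hy, pow_add]; push_cast; field_simp

theorem ofDyadic_intCast (n : ℤ) : ofDyadic (n : ZHalf) = ofInt n := by
  rw [← ofFrac_zero, ofDyadic_eq_ofFrac (m := 0) (k := n)]
  simp

/-- The value of a dyadic rational. -/
def numValue (x : ZHalf) : Value := value (ofDyadic x)

theorem numValue_le_numValue {x y : ZHalf} : numValue x ≤ numValue y ↔ x ≤ y := by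
  obtain ⟨m, k, l, hx, hy⟩ := exists_common_frac x y
  rw [numValue, numValue, value_le_value, ofDyadic_eq_ofFrac hx, ofDyadic_eq_ofFrac hy,
    ofFrac_le_ofFrac, ← Subtype.coe_le_coe, hx, hy, div_le_div_iff_of_pos_right (by positivity)]
  exact Int.cast_le.symm

theorem numValue_add (x y : ZHalf) : numValue (x + y) = numValue x + numValue y := by
  obtain ⟨m, k, l, hx, hy⟩ := exists_common_frac x y
  have hxy : ((x + y : ZHalf) : ℚ) = ((k + l : ℤ) : ℚ) / 2 ^ m := by
    push_cast
    rw [hx, hy, add_div]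
  rw [numValue, numValue, numValue, ofDyadic_eq_ofFrac hx, ofDyadic_eq_ofFrac hy,
    ofDyadic_eq_ofFrac hxy, value_ofFrac_add]

theorem ofDyadic_left (x : ZHalf) (i) : ∃ y < x, (ofDyadic x).left i = ofDyadic y := by
  obtain ⟨k, m, hx⟩ := x.2
  revert i
  rw [ofDyadic_eq_ofFrac hx]
  intro i
  obtain ⟨k', hk', h⟩ := ofFrac_left m k i
  refine ⟨⟨k' / 2 ^ m, k', m, rfl⟩, ?_, by rw [h, ofDyadic_eq_ofFrac (m := m) (k := k') rfl]⟩
  rw [← Subtype.coe_lt_coe, hx]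
  exact div_lt_div_of_pos_right (Int.cast_lt.2 hk') (by positivity)

theorem ofDyadic_right (x : ZHalf) (j) : ∃ y > x, (ofDyadic x).right j = ofDyadic y := by
  obtain ⟨k, m, hx⟩ := x.2
  revert j
  rw [ofDyadic_eq_ofFrac hx]
  intro j
  obtain ⟨k', hk', h⟩ := ofFrac_right m k j
  refine ⟨⟨k' / 2 ^ m, k', m, rfl⟩, ?_, by rw [h, ofDyadic_eq_ofFrac (m := m) (k := k') rfl]⟩
  rw [gt_iff_lt, ← Subtype.coe_lt_coe, hx]
  exact div_lt_div_of_pos_right (Int.cast_lt.2 hk') (by positivity)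

/-! ### Maxima and minima of finite families -/

theorem le_finMax {m : ℕ} (f : Fin m → ZHalf) (i : Fin m) : f i ≤ finMax f := by
  have h : (Finset.univ : Finset (Fin m)).Nonempty := ⟨i, Finset.mem_univ i⟩
  rw [finMax, dif_pos h]
  exact Finset.le_sup' f (Finset.mem_univ i)

theorem finMin_le {m : ℕ} (f : Fin m → ZHalf) (i : Fin m) : finMin f ≤ f i := by
  have h : (Finset.univ : Finset (Fin m)).Nonempty := ⟨i, Finset.mem_univ i⟩
  rw [finMin, dif_pos h]
  exact Finset.inf'_le f (Finset.mem_univ i)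

theorem exists_finMax_eq {m : ℕ} (hm : 0 < m) (f : Fin m → ZHalf) : ∃ i, finMax f = f i := by
  have h : (Finset.univ : Finset (Fin m)).Nonempty := ⟨⟨0, hm⟩, Finset.mem_univ _⟩
  rw [finMax, dif_pos h]
  obtain ⟨i, -, hi⟩ := Finset.exists_mem_eq_sup' h f
  exact ⟨i, hi⟩

theorem exists_finMin_eq {m : ℕ} (hm : 0 < m) (f : Fin m → ZHalf) : ∃ i, finMin f = f i := by
  have h : (Finset.univ : Finset (Fin m)).Nonempty := ⟨⟨0, hm⟩, Finset.mem_univ _⟩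
  rw [finMin, dif_pos h]
  obtain ⟨i, -, hi⟩ := Finset.exists_mem_eq_inf' h f
  exact ⟨i, hi⟩

theorem finMax_le_iff {m : ℕ} (hm : 0 < m) {f : Fin m → ZHalf} {c : ZHalf} :
    finMax f ≤ c ↔ ∀ i, f i ≤ c := by
  refine ⟨fun h i => (le_finMax f i).trans h, fun h => ?_⟩
  obtain ⟨i, hi⟩ := exists_finMax_eq hm f
  exact hi ▸ h i

theorem le_finMin_iff {m : ℕ} (hm : 0 < m) {f : Fin m → ZHalf} {c : ZHalf} :
    c ≤ finMin f ↔ ∀ i, c ≤ f i := by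
  refine ⟨fun h i => h.trans (finMin_le f i), fun h => ?_⟩
  obtain ⟨i, hi⟩ := exists_finMin_eq hm f
  exact hi ▸ h i

/-! ### Meeting points of piecewise linear functions on `ℤ[1/2]` -/

/-- The dyadic rational `1 / 2 ^ N`. -/
def mesh (N : ℕ) : ZHalf := ⟨1 / 2 ^ N, 1, N, by simp⟩

theorem mesh_pos (N : ℕ) : 0 < mesh N := by
  rw [← Subtype.coe_lt_coe]
  change (0 : ℚ) < 1 / 2 ^ N
  positivity

theorem two_pow_mul_mesh (N : ℕ) : 2 ^ N * mesh N = 1 := by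
  apply Subtype.ext
  change (2 : ℚ) ^ N * (1 / 2 ^ N) = 1
  field_simp

theorem two_mul_mesh_succ (N : ℕ) : 2 * mesh (N + 1) = mesh N := by
  apply Subtype.ext
  change (2 : ℚ) * (1 / 2 ^ (N + 1)) = 1 / 2 ^ N
  rw [pow_succ]
  field_simp

/-- `x` is an integer multiple of `1 / 2 ^ N`. -/
def OnGrid (N : ℕ) (x : ZHalf) : Prop := ∃ k : ℤ, x = k * mesh N

theorem OnGrid.succ {N : ℕ} {x : ZHalf} (h : OnGrid N x) : OnGrid (N + 1) x := by
  obtain ⟨k, rfl⟩ := h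
  refine ⟨2 * k, ?_⟩
  rw [← two_mul_mesh_succ N]
  push_cast
  ring

theorem OnGrid.mono {M N : ℕ} (hMN : M ≤ N) {x : ZHalf} (h : OnGrid M x) : OnGrid N x := by
  induction hMN with
  | refl => exact h
  | step _ ih => exact ih.succ

theorem OnGrid.add {N : ℕ} {x y : ZHalf} (hx : OnGrid N x) (hy : OnGrid N y) :
    OnGrid N (x + y) := by
  obtain ⟨k, rfl⟩ := hx
  obtain ⟨l, rfl⟩ := hy
  exact ⟨k + l, by push_cast; ring⟩

theorem OnGrid.neg {N : ℕ} {x : ZHalf} (hx : OnGrid N x) : OnGrid N (-x) := by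
  obtain ⟨k, rfl⟩ := hx
  exact ⟨-k, by push_cast; ring⟩

theorem OnGrid.sub {N : ℕ} {x y : ZHalf} (hx : OnGrid N x) (hy : OnGrid N y) :
    OnGrid N (x - y) := sub_eq_add_neg x y ▸ hx.add hy.neg

theorem onGrid_mesh (N : ℕ) : OnGrid N (mesh N) := ⟨1, by simp⟩

theorem onGrid_intCast (N : ℕ) (n : ℤ) : OnGrid N n :=
  ⟨n * 2 ^ N, by push_cast; rw [mul_assoc, two_pow_mul_mesh, mul_one]⟩

theorem OnGrid.exists_half {N : ℕ} {x : ZHalf} (h : OnGrid N x) :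
    ∃ y, OnGrid (N + 1) y ∧ 2 * y = x := by
  obtain ⟨k, rfl⟩ := h
  exact ⟨k * mesh (N + 1), ⟨k, rfl⟩, by rw [← two_mul_mesh_succ N]; ring⟩

theorem exists_le_intCast_mul_mesh (N : ℕ) (x : ZHalf) : ∃ k : ℤ, x ≤ k * mesh N := by
  obtain ⟨k, hk⟩ := exists_nat_ge ((x : ℚ) * 2 ^ N)
  refine ⟨k, ?_⟩
  rw [← Subtype.coe_le_coe]
  change (x : ℚ) ≤ _ * (1 / 2 ^ N)
  rw [mul_one_div, le_div_iff₀ (by positivity)]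
  simpa using hk

/-- An antitone `1`-Lipschitz function that preserves the grid is affine, of slope `0` or `-1`,
between neighbouring grid points. -/
theorem affine_of_onGrid {N : ℕ} {f : ZHalf → ZHalf} (hf : Antitone f)
    (hf' : Monotone fun t => f t + t) (hN : ∀ a, OnGrid N a → OnGrid N (f a)) {a : ZHalf}
    (ha : OnGrid N a) :
    (∀ s, a ≤ s → s ≤ a + mesh N → f s = f a) ∨
      ∀ s, a ≤ s → s ≤ a + mesh N → f s = f a - (s - a) := by
  have hpos := mesh_pos N
  obtain ⟨k, hk⟩ := (hN _ ha).sub (hN _ (ha.add (onGrid_mesh N)))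
  have h₁ : f (a + mesh N) ≤ f a := hf (by linarith)
  have h₂ : f a + a ≤ f (a + mesh N) + (a + mesh N) := hf' (by linarith)
  have hk₀ : 0 ≤ k := by
    by_contra! h
    have : (k : ZHalf) ≤ -1 := by exact_mod_cast Int.le_sub_one_of_lt h
    nlinarith
  have hk₁ : k ≤ 1 := by
    by_contra! h
    have : (2 : ZHalf) ≤ k := by exact_mod_cast h
    nlinarith
  obtain rfl | rfl : k = 0 ∨ k = 1 := by omega
  · left
    intro s hs hs'
    have h₃ := hf hs
    have h₄ := hf hs'
    simp only [Int.cast_zero, zero_mul] at hk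
    linarith
  · right
    intro s hs hs'
    have h₃ : f a + a ≤ f s + s := hf' hs
    have h₄ : f s + s ≤ f (a + mesh N) + (a + mesh N) := hf' hs'
    simp only [Int.cast_one, one_mul] at hk
    linarith

/-- `ℤ[1/2]` is not complete, so the meeting point has to be exhibited. In the grid cell where the
sign of `f - g` changes, both functions are affine and the gap closes at rate `1` or `2`, so they
meet on the grid or halfway between grid points; hence `N + 1`. -/
theorem exists_isLeast_meet {N : ℕ} {f g : ZHalf → ZHalf} (hf : Antitone f)
    (hf' : Monotone fun t => f t + t) (hg : Monotone g) (hg' : Antitone fun t => g t - t)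
    (hfN : ∀ a, OnGrid N a → OnGrid N (f a)) (hgN : ∀ a, OnGrid N a → OnGrid N (g a))
    {r : ZHalf} (hr : g r < f r) (h : ∃ s, f s ≤ g s) :
    ∃ T, IsLeast {s | f s = g s} T ∧ OnGrid (N + 1) T ∧ r < T := by
  have hpos := mesh_pos N
  have above : ∀ s, f s ≤ g s → r < s := fun s hs => by
    by_contra! hsr
    have := hf hsr
    have := hg hsr
    linarith
  obtain ⟨s, hs⟩ := h
  obtain ⟨k₀, hk₀⟩ := exists_le_intCast_mul_mesh N s
  obtain ⟨k₁, hk₁⟩ := exists_le_intCast_mul_mesh N (-r)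
  obtain ⟨k, hk, hmin⟩ := Int.exists_least_of_bdd
    (P := fun k : ℤ => f (k * mesh N) ≤ g (k * mesh N))
    ⟨-k₁, fun z hz => by
      by_contra! hlt
      have h₁ := above _ hz
      have h₂ : (z : ZHalf) ≤ -k₁ := by exact_mod_cast hlt.le
      nlinarith⟩
    ⟨k₀, (hf hk₀).trans (hs.trans (hg hk₀))⟩
  set a : ZHalf := ((k - 1 : ℤ) : ZHalf) * mesh N with ha_def
  have ha : OnGrid N a := ⟨k - 1, rfl⟩
  have hb : (k : ZHalf) * mesh N = a + mesh N := by rw [ha_def]; push_cast; ring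
  rw [hb] at hk
  have hpa : g a < f a := by
    by_contra! hle
    have := hmin (k - 1) hle
    omega
  have hlt : ∀ s ≤ a, g s < f s := fun s hs => (hg hs).trans_lt (hpa.trans_le (hf hs))
  -- It is enough to find the meeting point in the grid cell `[a, a + mesh N]`.
  have main : ∀ T, OnGrid (N + 1) T → a ≤ T → f T = g T →
      (∀ s, a ≤ s → s ≤ a + mesh N → f s = g s → T ≤ s) → T ≤ a + mesh N →
      ∃ T, IsLeast {s | f s = g s} T ∧ OnGrid (N + 1) T ∧ r < T := by
    intro T hT haT hfg hleast hTb
    refine ⟨T, ⟨hfg, fun s hs => ?_⟩, hT, above T hfg.le⟩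
    have hs : f s = g s := hs
    by_contra! hsT
    rcases le_or_gt s a with hsa | hsa
    · exact (hlt s hsa).ne' hs
    · exact absurd (hleast s hsa.le (by linarith) hs) (not_le.2 hsT)
  have hd : OnGrid N (f a - g a) := (hfN a ha).sub (hgN a ha)
  have hfb := affine_of_onGrid hf hf' hfN ha
  have hgb := affine_of_onGrid (f := fun t => -g t) hg.neg
    (fun s t hst => by have : g t - t ≤ g s - s := hg' hst; change -g s + s ≤ -g t + t; linarith)
    (fun b hb => (hgN b hb).neg) ha
  rcases hfb with hfb | hfb <;> rcases hgb with hgb | hgb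
  · have h₁ := hfb (a + mesh N) (by linarith) le_rfl
    have h₂ := hgb (a + mesh N) (by linarith) le_rfl
    linarith
  · have h₁ := hfb (a + mesh N) (by linarith) le_rfl
    have h₂ := hgb (a + mesh N) (by linarith) le_rfl
    have h₃ := hfb (a + (f a - g a)) (by linarith) (by linarith)
    have h₄ := hgb (a + (f a - g a)) (by linarith) (by linarith)
    refine main (a + (f a - g a)) (ha.add hd).succ (by linarith) (by linarith) ?_ (by linarith)
    intro s hs hs' hfg
    have h₅ := hfb s hs hs'
    have h₆ := hgb s hs hs'
    linarith
  · have h₁ := hfb (a + mesh N) (by linarith) le_rfl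
    have h₂ := hgb (a + mesh N) (by linarith) le_rfl
    have h₃ := hfb (a + (f a - g a)) (by linarith) (by linarith)
    have h₄ := hgb (a + (f a - g a)) (by linarith) (by linarith)
    refine main (a + (f a - g a)) (ha.add hd).succ (by linarith) (by linarith) ?_ (by linarith)
    intro s hs hs' hfg
    have h₅ := hfb s hs hs'
    have h₆ := hgb s hs hs'
    linarith
  -- Both functions move, so they meet after half of the initial gap.
  · obtain ⟨d, hdN, hd⟩ := hd.exists_half
    have h₁ := hfb (a + mesh N) (by linarith) le_rfl
    have h₂ := hgb (a + mesh N) (by linarith) le_rfl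
    have h₃ := hfb (a + d) (by linarith) (by linarith)
    have h₄ := hgb (a + d) (by linarith) (by linarith)
    refine main (a + d) (ha.succ.add hdN) (by linarith) (by linarith) ?_ (by linarith)
    intro s hs hs' hfg
    have h₅ := hfb s hs hs'
    have h₆ := hgb s hs hs'
    linarith

/-! ### Games and integers -/

theorem exists_le_ofInt (G : FormalGame) : ∃ n : ℕ, G ≤ ofInt n := by
  induction G with
  | mk L R ihL _ =>
    choose f hf using ihL
    have hsum : ∀ i, f i ≤ ∑ i, f i := fun i =>
      Finset.single_le_sum (fun i _ => Nat.zero_le _) (Finset.mem_univ i)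
    -- Right has no move in a natural number, so it suffices to exceed the bounds of all Left
    -- options.
    refine ⟨(∑ i, f i) + 1, (le_def _ _).2 ⟨fun i h => ?_, fun j => ?_⟩⟩
    · have h₁ := ofInt_le_ofInt.1 (h.trans (hf i))
      have h₂ := hsum i
      omega
    · have := (ofInt_right _ j).1
      omega

theorem exists_ofInt_le (G : FormalGame) : ∃ n : ℕ, ofInt (-n) ≤ G := by
  obtain ⟨n, hn⟩ := exists_le_ofInt (-G)
  refine ⟨n, ?_⟩
  rw [← value_le_value, value_neg] at hn
  rw [ofInt_neg_natCast, ← value_le_value, value_neg]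
  exact neg_le.1 hn

/-- A game that is not equal to an integer is at least `n` if Left, moving second, survives the
moves of Right in the game itself. -/
theorem ofInt_le_of_forall_right {G : FormalGame} (hG : ¬ IsInt G) {n : ℤ}
    (h : ∀ j, ¬ G.right j ≤ ofInt n) : ofInt n ≤ G := by
  classical
  refine (le_def _ _).2 ⟨fun i hle => hG ?_, h⟩
  obtain ⟨hn, hi⟩ := ofInt_left n i
  rw [hi] at hle
  -- If moving from `n` to `n - 1` refuted the claim, the least natural number above `G` would be at
  -- most `n - 1`, and `h` would force `G` to equal it.
  have hex := exists_le_ofInt G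
  have hk : (Nat.find hex : ℤ) ≤ n - 1 := by
    obtain ⟨m, hm⟩ := Int.eq_ofNat_of_zero_le (show 0 ≤ n - 1 by omega)
    rw [hm] at hle ⊢
    exact_mod_cast Nat.find_min' hex hle
  refine ⟨Nat.find hex, Nat.find_spec hex, (le_def _ _).2 ⟨fun i' h' => ?_, fun j h' => ?_⟩⟩
  · obtain ⟨hpos, hi'⟩ := ofInt_left _ i'
    rw [hi'] at h'
    obtain ⟨m, hm⟩ := Int.eq_ofNat_of_zero_le (show 0 ≤ (Nat.find hex : ℤ) - 1 by omega)
    rw [hm] at h'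
    have := Nat.find_min' hex h'
    omega
  · exact h j (h'.trans (ofInt_le_ofInt.2 (by omega)))

theorem le_ofInt_of_forall_left {G : FormalGame} (hG : ¬ IsInt G) {n : ℤ}
    (h : ∀ i, ¬ ofInt n ≤ G.left i) : G ≤ ofInt n := by
  classical
  refine (le_def _ _).2 ⟨h, fun j hle => hG ?_⟩
  obtain ⟨hn, hj⟩ := ofInt_right n j
  rw [hj] at hle
  have hex := exists_ofInt_le G
  have hk : n + 1 ≤ -(Nat.find hex : ℤ) := by
    obtain ⟨m, hm⟩ := Int.eq_ofNat_of_zero_le (show 0 ≤ -(n + 1) by omega)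
    rw [show n + 1 = -(m : ℤ) by omega] at hle
    have := Nat.find_min' hex hle
    omega
  refine ⟨-Nat.find hex, (le_def _ _).2 ⟨fun i h' => ?_, fun j' h' => ?_⟩, Nat.find_spec hex⟩
  · exact h i ((ofInt_le_ofInt.2 (by omega)).trans h')
  · obtain ⟨hneg, hj'⟩ := ofInt_right _ j'
    rw [hj'] at h'
    obtain ⟨m, hm⟩ := Int.eq_ofNat_of_zero_le (show 0 ≤ (Nat.find hex : ℤ) - 1 by omega)
    rw [show -(Nat.find hex : ℤ) + 1 = -(m : ℤ) by omega] at h'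
    have := Nat.find_min' hex h'
    omega

/-- Without Right options `G` would exceed every integer. This keeps the default value of `finMin`
out of play. -/
theorem numRight_pos {G : FormalGame} (hG : ¬ IsInt G) : 0 < G.numRight := by
  by_contra! h
  obtain ⟨n, hn⟩ := exists_le_ofInt G
  have h₁ : ofInt (n + 1) ≤ G := ofInt_le_of_forall_right hG fun j => absurd j.2 (by omega)
  have := ofInt_le_ofInt.1 (h₁.trans hn)
  omega

theorem numLeft_pos {G : FormalGame} (hG : ¬ IsInt G) : 0 < G.numLeft := by
  by_contra! h
  obtain ⟨n, hn⟩ := exists_ofInt_le G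
  have h₁ : G ≤ ofInt (-n - 1) := le_ofInt_of_forall_left hG fun j => absurd j.2 (by omega)
  have := ofInt_le_ofInt.1 (hn.trans h₁)
  omega

/-! ### The shape of thermographs -/

theorem walls_of_isInt {G : FormalGame} (h : IsInt G) : ∃ n : ℤ, Equal G (ofInt n) ∧
    ∀ t, leftWall t G = n ∧ rightWall t G = n ∧ cool t G = ofInt n := by
  refine ⟨h.choose, h.choose_spec, fun t => ?_⟩
  cases G with
  | mk L R => simp only [leftWall, rightWall, walls, cool, dif_pos h, and_self]

/-- The thermograph of `G` is well formed: the walls are monotone, `1`-Lipschitz and piecewise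
linear with dyadic nodes, they meet unless `G` is an integer, and their values at `-1` are the
least integer above `G` and the greatest integer below it. -/
structure HasThermograph (G : FormalGame) : Prop where
  leftWall_antitone : Antitone fun t => leftWall t G
  leftWall_add_monotone : Monotone fun t => leftWall t G + t
  rightWall_monotone : Monotone fun t => rightWall t G
  rightWall_sub_antitone : Antitone fun t => rightWall t G - t
  rightWall_le_leftWall : ∀ t, rightWall t G ≤ leftWall t G
  onGrid : ∃ N, ∀ M ≥ N, ∀ a, OnGrid M a → OnGrid M (leftWall a G) ∧ OnGrid M (rightWall a G)
  leftWall_int : ∃ n : ℤ, leftWall (-1) G = n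
  rightWall_int : ∃ n : ℤ, rightWall (-1) G = n
  le_ofInt_iff : ∀ n : ℤ, G ≤ ofInt n ↔ leftWall (-1) G ≤ n
  ofInt_le_iff : ∀ n : ℤ, ofInt n ≤ G ↔ n ≤ rightWall (-1) G
  isLeast_meetTime : ¬ IsInt G → IsLeast {s | leftScaffold s G = rightScaffold s G} (meetTime G)
  neg_one_lt_meetTime : ¬ IsInt G → -1 < meetTime G

theorem hasThermograph_of_isInt {G : FormalGame} (h : IsInt G) : HasThermograph G := by
  obtain ⟨n, hn, hw⟩ := walls_of_isInt h
  have hl : ∀ t, leftWall t G = n := fun t => (hw t).1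
  have hr : ∀ t, rightWall t G = n := fun t => (hw t).2.1
  constructor
  all_goals try simp only [hl, hr]
  · exact antitone_const
  · exact fun s t hst => by simpa using hst
  · exact monotone_const
  · exact fun s t hst => sub_le_sub_left hst _
  · exact fun _ => le_rfl
  · exact ⟨0, fun M _ a _ => ⟨onGrid_intCast M n, onGrid_intCast M n⟩⟩
  · exact ⟨n, rfl⟩
  · exact ⟨n, rfl⟩
  · intro m
    rw [Int.cast_le, ← ofInt_le_ofInt]
    exact ⟨hn.2.trans, hn.1.trans⟩
  · intro m
    rw [Int.cast_le, ← ofInt_le_ofInt]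
    exact ⟨fun h => h.trans hn.1, fun h => h.trans hn.2⟩
  · exact fun h' => absurd h h'
  · exact fun h' => absurd h h'

/-- Freezing amounts to stopping the clock at `meetTime G`, which removes the case distinction from
the recursion. -/
theorem leftWall_eq_leftScaffold_min {G : FormalGame} (hG : ¬ IsInt G) (t : ZHalf) :
    leftWall t G = leftScaffold (min t (meetTime G)) G := by
  have hm : mast G = leftScaffold (meetTime G) G := by
    rw [mast, leftWall_of_not_isInt _ _ hG]
    simp [temperature, hG]
  rw [leftWall_of_not_isInt _ _ hG, temperature, if_neg hG]
  simp only [WithBot.coe_le_coe, hm]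
  split_ifs with h
  · rw [min_eq_left h]
  · rw [min_eq_right (not_le.1 h).le]

theorem rightWall_eq_rightScaffold_min {G : FormalGame} (hG : ¬ IsInt G)
    (hT : leftScaffold (meetTime G) G = rightScaffold (meetTime G) G) (t : ZHalf) :
    rightWall t G = rightScaffold (min t (meetTime G)) G := by
  have hm : mast G = leftScaffold (meetTime G) G := by
    rw [mast, leftWall_of_not_isInt _ _ hG]
    simp [temperature, hG]
  rw [rightWall_of_not_isInt _ _ hG, temperature, if_neg hG]
  simp only [WithBot.coe_le_coe, hm, hT]
  split_ifs with h
  · rw [min_eq_left h]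
  · rw [min_eq_right (not_le.1 h).le]

theorem hasThermograph_of_options {G : FormalGame} (hG : ¬ IsInt G)
    (hL : ∀ i, HasThermograph (G.left i)) (hR : ∀ j, HasThermograph (G.right j)) :
    HasThermograph G := by
  have hl := numLeft_pos hG
  have hr := numRight_pos hG
  have lam_anti : Antitone fun t => leftScaffold t G := fun s t hst => by
    refine (finMax_le_iff hl).2 fun i => ?_
    exact ((hL i).rightWall_sub_antitone hst).trans
      (le_finMax (fun i => rightWall s (G.left i) - s) i)
  have lam_add : Monotone fun t => leftScaffold t G + t := fun s t hst => by
    change leftScaffold s G + s ≤ leftScaffold t G + t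
    rw [← le_sub_iff_add_le]
    refine (finMax_le_iff hl).2 fun i => ?_
    have h₁ : rightWall s (G.left i) ≤ rightWall t (G.left i) := (hL i).rightWall_monotone hst
    have h₂ : rightWall t (G.left i) - t ≤ leftScaffold t G :=
      le_finMax (fun i => rightWall t (G.left i) - t) i
    linarith
  have rho_mono : Monotone fun t => rightScaffold t G := fun s t hst => by
    refine (le_finMin_iff hr).2 fun j => ?_
    exact (finMin_le (fun j => leftWall s (G.right j) + s) j).trans
      ((hR j).leftWall_add_monotone hst)
  have rho_sub : Antitone fun t => rightScaffold t G - t := fun s t hst => by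
    change rightScaffold t G - t ≤ rightScaffold s G - s
    rw [le_sub_iff_add_le]
    refine (le_finMin_iff hr).2 fun j => ?_
    have h₁ : leftWall t (G.right j) ≤ leftWall s (G.right j) := (hR j).leftWall_antitone hst
    have h₂ : rightScaffold t G ≤ leftWall t (G.right j) + t :=
      finMin_le (fun j => leftWall t (G.right j) + t) j
    linarith
  obtain ⟨N, hN⟩ : ∃ N, ∀ M ≥ N, ∀ a, OnGrid M a →
      OnGrid M (leftScaffold a G) ∧ OnGrid M (rightScaffold a G) := by
    choose f hf using fun i => (hL i).onGrid
    choose g hg using fun j => (hR j).onGrid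
    refine ⟨(∑ i, f i) + ∑ j, g j, fun M hM a ha => ⟨?_, ?_⟩⟩
    · obtain ⟨i, hi⟩ := exists_finMax_eq hl fun i => rightWall a (G.left i) - a
      have := Finset.single_le_sum (f := f) (fun i _ => Nat.zero_le _) (Finset.mem_univ i)
      rw [leftScaffold, hi]
      exact (hf i M (by omega) a ha).2.sub ha
    · obtain ⟨j, hj⟩ := exists_finMin_eq hr fun j => leftWall a (G.right j) + a
      have := Finset.single_le_sum (f := g) (fun i _ => Nat.zero_le _) (Finset.mem_univ j)
      rw [rightScaffold, hj]
      exact (hg j M (by omega) a ha).1.add ha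
  have lam_int : ∃ n : ℤ, leftScaffold (-1) G = n := by
    obtain ⟨i, hi⟩ := exists_finMax_eq hl fun i => rightWall (-1) (G.left i) - (-1)
    obtain ⟨n, hn⟩ := (hL i).rightWall_int
    exact ⟨n + 1, by rw [leftScaffold, hi, hn]; push_cast; ring⟩
  have rho_int : ∃ n : ℤ, rightScaffold (-1) G = n := by
    obtain ⟨j, hj⟩ := exists_finMin_eq hr fun j => leftWall (-1) (G.right j) + (-1)
    obtain ⟨n, hn⟩ := (hR j).leftWall_int
    exact ⟨n - 1, by rw [rightScaffold, hj, hn]; push_cast; ring⟩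
  -- By integer avoidance only Left's moves matter. `G^L` fails to be at least `n` exactly when its
  -- integer floor is at most `n - 1`; this unit is the tax at `-1`.
  have le_int : ∀ n : ℤ, G ≤ ofInt n ↔ leftScaffold (-1) G ≤ n := fun n => by
    have h₁ : G ≤ ofInt n ↔ ∀ i, ¬ ofInt n ≤ G.left i :=
      ⟨fun h => ((le_def _ _).1 h).1, le_ofInt_of_forall_left hG⟩
    rw [h₁, leftScaffold, finMax_le_iff hl]
    refine forall_congr' fun i => ?_
    obtain ⟨m, hm⟩ := (hL i).rightWall_int
    rw [(hL i).ofInt_le_iff, hm, not_le, Int.cast_lt, sub_neg_eq_add]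
    exact_mod_cast Iff.rfl
  have int_le : ∀ n : ℤ, ofInt n ≤ G ↔ n ≤ rightScaffold (-1) G := fun n => by
    have h₁ : ofInt n ≤ G ↔ ∀ j, ¬ G.right j ≤ ofInt n :=
      ⟨fun h => ((le_def _ _).1 h).2, ofInt_le_of_forall_right hG⟩
    rw [h₁, rightScaffold, le_finMin_iff hr]
    refine forall_congr' fun j => ?_
    obtain ⟨m, hm⟩ := (hR j).leftWall_int
    rw [(hR j).le_ofInt_iff, hm, not_le, Int.cast_lt, ← sub_eq_add_neg, le_sub_iff_add_le]
    exact_mod_cast Iff.rfl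
  -- Equality of the two integer roundings would make `G` an integer.
  have hneg : rightScaffold (-1) G < leftScaffold (-1) G := by
    obtain ⟨p, hp⟩ := rho_int
    obtain ⟨q, hq⟩ := lam_int
    have h₁ := (int_le p).2 hp.ge
    have h₂ := (le_int q).2 hq.le
    have h₃ := ofInt_le_ofInt.1 (h₁.trans h₂)
    rw [hp, hq, Int.cast_lt]
    exact lt_of_le_of_ne h₃ fun h => hG ⟨p, h ▸ h₂, h₁⟩
  -- Beyond `0` the walls of the options stay within their values at `0`, so a sufficiently large
  -- tax makes the scaffolds cross.
  have hmeet : ∃ s, leftScaffold s G ≤ rightScaffold s G := by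
    obtain ⟨k, hk⟩ := exists_le_intCast_mul_mesh 0
      (max 0 (finMax (fun i => leftWall 0 (G.left i)) - finMin fun j => rightWall 0 (G.right j)))
    obtain ⟨hk₀, hk₁⟩ := max_le_iff.1 hk
    refine ⟨k * mesh 0, (finMax_le_iff hl).2 fun i => (le_finMin_iff hr).2 fun j => ?_⟩
    set s : ZHalf := k * mesh 0
    have h₁ : leftWall s (G.left i) ≤ leftWall 0 (G.left i) := (hL i).leftWall_antitone hk₀
    have h₂ : rightWall 0 (G.right j) ≤ rightWall s (G.right j) := (hR j).rightWall_monotone hk₀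
    have h₃ := (hL i).rightWall_le_leftWall s
    have h₄ := (hR j).rightWall_le_leftWall s
    have h₅ := le_finMax (fun i => leftWall 0 (G.left i)) i
    have h₆ := finMin_le (fun j => rightWall 0 (G.right j)) j
    linarith
  obtain ⟨T, hT, hTN, hT₁⟩ := exists_isLeast_meet lam_anti lam_add rho_mono rho_sub
    (fun a ha => (hN N le_rfl a ha).1) (fun a ha => (hN N le_rfl a ha).2) hneg hmeet
  have hleast : IsLeast {s | leftScaffold s G = rightScaffold s G} (meetTime G) :=
    Classical.epsilon_spec
      (p := fun s => IsLeast {s | leftScaffold s G = rightScaffold s G} s) ⟨T, hT⟩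
  obtain rfl : T = meetTime G := hT.unique hleast
  have hlam := leftWall_eq_leftScaffold_min hG
  have hrho := rightWall_eq_rightScaffold_min hG hleast.1
  -- Stopping the clock is monotone and `1`-Lipschitz, so the walls inherit these properties from
  -- the scaffolds.
  have hmin : ∀ s t : ZHalf, s ≤ t → min s (meetTime G) ≤ min t (meetTime G) ∧
      min t (meetTime G) - min s (meetTime G) ≤ t - s := fun s t hst => by
    refine ⟨min_le_min_right _ hst, ?_⟩
    rcases le_total s (meetTime G) with h | h
    · rw [min_eq_left h]
      linarith [min_le_left t (meetTime G)]
    · rw [min_eq_right h, min_eq_right (h.trans hst)]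
      linarith
  constructor
  all_goals try simp only [hlam, hrho, min_eq_left hT₁.le]
  · exact fun s t hst => lam_anti (hmin s t hst).1
  · intro s t hst
    have h₁ : leftScaffold (min s (meetTime G)) G + min s (meetTime G) ≤
      leftScaffold (min t (meetTime G)) G + min t (meetTime G) := lam_add (hmin s t hst).1
    have h₂ := (hmin s t hst).2
    change _ + s ≤ _ + t
    linarith
  · exact fun s t hst => rho_mono (hmin s t hst).1
  · intro s t hst
    have h₁ : rightScaffold (min t (meetTime G)) G - min t (meetTime G) ≤
      rightScaffold (min s (meetTime G)) G - min s (meetTime G) := rho_sub (hmin s t hst).1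
    have h₂ := (hmin s t hst).2
    change _ - t ≤ _ - s
    linarith
  · intro t
    have h : min t (meetTime G) ≤ meetTime G := min_le_right _ _
    exact (rho_mono h).trans (hT.1.symm.le.trans (lam_anti h))
  · refine ⟨N + 1, fun M hM a ha => hN M (by omega) _ ?_⟩
    rcases min_choice a (meetTime G) with h | h
    · rwa [h]
    · rw [h]
      exact hTN.mono hM
  · exact lam_int
  · exact rho_int
  · exact le_int
  · exact int_le
  · exact fun _ => hleast
  · exact fun _ => hT₁

theorem hasThermograph (G : FormalGame) : HasThermograph G := by
  induction G with
  | mk L R ihL ihR =>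
    by_cases h : IsInt (mk L R)
    · exact hasThermograph_of_isInt h
    · exact hasThermograph_of_options h ihL ihR

/-! ### Cooled games and their stops -/

theorem numValue_sub (x y : ZHalf) : numValue (x - y) = numValue x - numValue y := by
  rw [eq_sub_iff_add_eq, ← numValue_add, sub_add_cancel]

theorem exists_strictly_between {x y : ZHalf} (h : x < y) : ∃ z, x < z ∧ z < y := by
  obtain ⟨k, m, hk⟩ := (x + y).2
  let z : ZHalf := ⟨k / 2 ^ (m + 1), k, m + 1, rfl⟩
  have hz : 2 * z = x + y := by
    apply Subtype.ext
    rw [hk]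
    change (2 : ℚ) * (k / 2 ^ (m + 1)) = k / 2 ^ m
    rw [pow_succ]
    field_simp
  exact ⟨z, by linarith, by linarith⟩

/-- The value of `G` cooled by `t`. -/
noncomputable def coolValue (t : ZHalf) (G : FormalGame) : Value := value (cool t G)

/-- `G` is not yet frozen at temperature `t`: it is not an integer, and `t` is at
most its temperature. -/
def Active (t : ZHalf) (G : FormalGame) : Prop := ¬ IsInt G ∧ t ≤ meetTime G

/-- The walls of the thermograph of `G` coincide from `t` on. -/
def Settled (t : ZHalf) (G : FormalGame) : Prop := ¬ IsInt G → meetTime G ≤ t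

/-- At its meeting time a non-integer is both `Active` and `Settled`: the recursion still applies,
yet the walls are final. The arguments that go back from `t` to a freezing temperature rest on this
overlap. -/
theorem Settled.walls_eq {s t : ZHalf} {G : FormalGame} (h : Settled s G) (hst : s ≤ t) :
    leftWall s G = leftWall t G ∧ rightWall s G = leftWall t G ∧ rightWall t G = leftWall t G := by
  by_cases hG : IsInt G
  · obtain ⟨n, -, hn⟩ := walls_of_isInt hG
    simp only [hn, and_self]
  · have hT := ((hasThermograph G).isLeast_meetTime hG).1
    rw [leftWall_eq_leftScaffold_min hG, leftWall_eq_leftScaffold_min hG,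
      rightWall_eq_rightScaffold_min hG hT, rightWall_eq_rightScaffold_min hG hT,
      min_eq_right (h hG), min_eq_right ((h hG).trans hst)]
    exact ⟨rfl, hT.symm, hT.symm⟩

theorem settled_of_not_active {t : ZHalf} {G : FormalGame} (h : ¬ Active t G) : Settled t G :=
  fun hG => (not_le.1 fun h' => h ⟨hG, h'⟩).le

theorem cool_of_not_active {t : ZHalf} {G : FormalGame} (h : ¬ Active t G) :
    cool t G = ofDyadic (leftWall t G) := by
  by_cases hG : IsInt G
  · obtain ⟨n, -, hn⟩ := walls_of_isInt hG
    rw [(hn t).1, (hn t).2.2, ofDyadic_intCast]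
  · have hlt : ¬ (t : WithBot ZHalf) ≤ temperature G := by
      rw [temperature, if_neg hG, WithBot.coe_le_coe]
      exact fun h' => h ⟨hG, h'⟩
    rw [cool_of_not_isInt t G hG, leftWall_of_not_isInt t G hG, if_neg hlt, if_neg hlt]

theorem coolValue_of_not_active {t : ZHalf} {G : FormalGame} (h : ¬ Active t G) :
    coolValue t G = numValue (leftWall t G) := by
  rw [coolValue, cool_of_not_active h, numValue]

theorem exists_settled_lt {s t : ZHalf} {G : FormalGame} (h : ¬ Active t G) (hst : s < t) :
    ∃ r, s ≤ r ∧ r < t ∧ Settled r G := by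
  by_cases hG : IsInt G
  · exact ⟨s, le_rfl, hst, fun h' => absurd hG h'⟩
  · exact ⟨max s (meetTime G), le_max_left _ _, max_lt hst (not_le.1 fun h' => h ⟨hG, h'⟩),
      fun _ => le_max_right _ _⟩

/-! ### Moves in unfrozen cooled games -/

namespace Active

variable {t : ZHalf} {G H : FormalGame}

theorem cool_eq (h : Active t G) : cool t G =
    mk (fun i => cool t (G.left i) - ofDyadic t) (fun j => cool t (G.right j) + ofDyadic t) := by
  rw [cool_of_not_isInt t G h.1, if_pos]
  rw [temperature, if_neg h.1]
  exact WithBot.coe_le_coe.2 h.2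

theorem leftWall_eq (h : Active t G) : leftWall t G = leftScaffold t G := by
  rw [leftWall_eq_leftScaffold_min h.1, min_eq_left h.2]

theorem rightWall_eq (h : Active t G) : rightWall t G = rightScaffold t G := by
  rw [rightWall_eq_rightScaffold_min h.1 ((hasThermograph G).isLeast_meetTime h.1).1,
    min_eq_left h.2]

theorem of_le {s : ZHalf} (h : Active t G) (hst : s ≤ t) : Active s G := ⟨h.1, hst.trans h.2⟩

theorem leftWall_le_iff (h : Active t G) {x : ZHalf} :
    leftWall t G ≤ x ↔ ∀ i, rightWall t (G.left i) ≤ x + t := by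
  simp only [h.leftWall_eq, leftScaffold, finMax_le_iff (numLeft_pos h.1), sub_le_iff_le_add]

theorem le_rightWall_iff (h : Active t G) {x : ZHalf} :
    x ≤ rightWall t G ↔ ∀ j, x - t ≤ leftWall t (G.right j) := by
  simp only [h.rightWall_eq, rightScaffold, le_finMin_iff (numRight_pos h.1), sub_le_iff_le_add]

theorem lt_leftWall_iff (h : Active t G) {x : ZHalf} :
    x < leftWall t G ↔ ∃ i, x + t < rightWall t (G.left i) := by
  simpa using not_congr (h.leftWall_le_iff (x := x))

theorem rightWall_lt_iff (h : Active t G) {x : ZHalf} :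
    rightWall t G < x ↔ ∃ j, leftWall t (G.right j) < x - t := by
  simpa only [not_le, not_forall] using not_congr (h.le_rightWall_iff (x := x))

theorem not_coolValue_le_left (h : Active t G) (i) :
    ¬ coolValue t G ≤ coolValue t (G.left i) - numValue t := by
  rw [coolValue, coolValue, numValue, ← value_sub, value_le_value, h.cool_eq]
  exact not_le_left (mk (fun i => cool t (G.left i) - ofDyadic t)
    (fun j => cool t (G.right j) + ofDyadic t)) i

theorem not_right_le_coolValue (h : Active t G) (j) :
    ¬ coolValue t (G.right j) + numValue t ≤ coolValue t G := by
  rw [coolValue, coolValue, numValue, ← value_add, value_le_value, h.cool_eq]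
  exact not_right_le (mk (fun i => cool t (G.left i) - ofDyadic t)
    (fun j => cool t (G.right j) + ofDyadic t)) j

theorem coolValue_le_coolValue (hG : Active t G) (hH : Active t H)
    (hl : ∀ i, ¬ coolValue t H ≤ coolValue t (G.left i) - numValue t)
    (hr : ∀ j, ¬ coolValue t (H.right j) + numValue t ≤ coolValue t G) :
    coolValue t G ≤ coolValue t H := by
  rw [coolValue, coolValue, value_le_value, le_def]
  constructor
  · rw [hG.cool_eq]
    intro i
    rw [← value_le_value]
    change ¬ _ ≤ value (cool t (G.left i) - ofDyadic t)
    rw [value_sub]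
    exact hl i
  · rw [hH.cool_eq]
    exact hr

/-- If Right moves from `x` to some `y > x`, Left need not reply in the number: a taxed Right option
of `G` at most `y` shows that `y ≰ G_t`. -/
theorem coolValue_le_numValue_of_right (h : Active t G) {x : ZHalf}
    (hl : ∀ i, ¬ numValue (x + t) ≤ coolValue t (G.left i))
    (hr : ∀ y > x, ∃ j, coolValue t (G.right j) ≤ numValue (y - t)) :
    coolValue t G ≤ numValue x := by
  have hr' : ∀ j, ¬ (ofDyadic x).right j ≤ cool t G := by
    intro j hj
    obtain ⟨y, hy, hxy⟩ := ofDyadic_right x j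
    obtain ⟨j', hj'⟩ := hr y hy
    rw [numValue_sub] at hj'
    refine h.not_right_le_coolValue j' ((le_sub_iff_add_le.1 hj').trans ?_)
    rw [hxy] at hj
    exact hj
  rw [coolValue, numValue, value_le_value, le_def]
  refine ⟨?_, hr'⟩
  rw [h.cool_eq]
  intro i
  rw [← value_le_value]
  change ¬ _ ≤ value (cool t (G.left i) - ofDyadic t)
  rw [value_sub, le_sub_iff_add_le]
  have := hl i
  rwa [numValue_add] at this

theorem numValue_le_coolValue_of_left (h : Active t G) {x : ZHalf}
    (hl : ∀ y < x, ∃ i, numValue (y + t) ≤ coolValue t (G.left i))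
    (hr : ∀ j, ¬ coolValue t (G.right j) ≤ numValue (x - t)) :
    numValue x ≤ coolValue t G := by
  have hl' : ∀ i, ¬ cool t G ≤ (ofDyadic x).left i := by
    intro i hi
    obtain ⟨y, hy, hxy⟩ := ofDyadic_left x i
    obtain ⟨i', hi'⟩ := hl y hy
    rw [numValue_add] at hi'
    refine h.not_coolValue_le_left i' (le_trans ?_ (le_sub_iff_add_le.2 hi'))
    rw [hxy] at hi
    exact hi
  rw [coolValue, numValue, value_le_value, le_def]
  refine ⟨hl', ?_⟩
  rw [h.cool_eq]
  intro j
  rw [← value_le_value]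
  change ¬ value (cool t (G.right j)) + value (ofDyadic t) ≤ _
  rw [← le_sub_iff_add_le]
  have := hr j
  rwa [numValue_sub] at this

end Active

/-- The walls of `G` at `t` are the Left and Right stops of `G` cooled by `t`. -/
structure HasStops (t : ZHalf) (G : FormalGame) : Prop where
  le_of_lt : ∀ y, leftWall t G < y → coolValue t G ≤ numValue y
  not_le_of_lt : ∀ y, y < leftWall t G → ¬ coolValue t G ≤ numValue y
  ge_of_lt : ∀ y, y < rightWall t G → numValue y ≤ coolValue t G
  not_ge_of_lt : ∀ y, rightWall t G < y → ¬ numValue y ≤ coolValue t G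

theorem hasStops_of_options {t : ZHalf} {G : FormalGame} (hL : ∀ i, HasStops t (G.left i))
    (hR : ∀ j, HasStops t (G.right j)) : HasStops t G := by
  have hle := (hasThermograph G).rightWall_le_leftWall t
  by_cases h : Active t G
  · constructor
    · intro y hy
      refine h.coolValue_le_numValue_of_right (fun i => ?_) fun z hz => ?_
      -- The intermediate `y'` turns the weak bound on the walls of the Left options into a strict
      -- one.
      · obtain ⟨y', h₁, h₂⟩ := exists_strictly_between hy
        have := h.leftWall_le_iff.1 h₁.le i
        exact (hL i).not_ge_of_lt _ (by linarith)
      · obtain ⟨j, hj⟩ := h.rightWall_lt_iff.1 (hle.trans_lt (hy.trans hz))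
        exact ⟨j, (hR j).le_of_lt _ hj⟩
    · intro y hy hc
      obtain ⟨i, hi⟩ := h.lt_leftWall_iff.1 hy
      have := (hL i).ge_of_lt _ hi
      rw [numValue_add] at this
      exact h.not_coolValue_le_left i (hc.trans (le_sub_iff_add_le.2 this))
    · intro y hy
      refine h.numValue_le_coolValue_of_left (fun z hz => ?_) fun j => ?_
      · obtain ⟨i, hi⟩ := h.lt_leftWall_iff.1 (hz.trans (hy.trans_le hle))
        exact ⟨i, (hL i).ge_of_lt _ hi⟩
      · obtain ⟨y', h₁, h₂⟩ := exists_strictly_between hy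
        have := h.le_rightWall_iff.1 h₂.le j
        exact (hR j).not_le_of_lt _ (by linarith)
    · intro y hy hc
      obtain ⟨j, hj⟩ := h.rightWall_lt_iff.1 hy
      have := (hR j).le_of_lt _ hj
      rw [numValue_sub] at this
      exact h.not_right_le_coolValue j ((le_sub_iff_add_le.1 this).trans hc)
  · have hw := ((settled_of_not_active h).walls_eq le_rfl).2.2
    constructor
    all_goals
      intro y hy
      rw [coolValue_of_not_active h, numValue_le_numValue]
    · exact hy.le
    · exact not_le.2 hy
    · exact (hy.trans_eq hw).le
    · exact not_le.2 (hw.symm.trans_lt hy)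

theorem hasStops (t : ZHalf) (G : FormalGame) : HasStops t G := by
  induction G with
  | mk L R ihL ihR => exact hasStops_of_options ihL ihR

/-- Number avoidance: `hl` already bounds the Left stop by `x`, hence the Right stop too, so for
each `y > x` some Right option has its stop below `y - t`. -/
theorem Active.coolValue_le_numValue {t : ZHalf} {G : FormalGame} (h : Active t G) {x : ZHalf}
    (hl : ∀ i, ¬ numValue (x + t) ≤ coolValue t (G.left i)) : coolValue t G ≤ numValue x := by
  refine h.coolValue_le_numValue_of_right hl fun y hy => ?_
  have hx : leftWall t G ≤ x := h.leftWall_le_iff.2 fun i =>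
    not_lt.1 fun hlt => hl i ((hasStops t _).ge_of_lt _ hlt)
  obtain ⟨j, hj⟩ := h.rightWall_lt_iff.1
    (((hasThermograph G).rightWall_le_leftWall t).trans_lt (hx.trans_lt hy))
  exact ⟨j, (hasStops t _).le_of_lt _ hj⟩

theorem Active.numValue_le_coolValue {t : ZHalf} {G : FormalGame} (h : Active t G) {x : ZHalf}
    (hr : ∀ j, ¬ coolValue t (G.right j) ≤ numValue (x - t)) : numValue x ≤ coolValue t G := by
  refine h.numValue_le_coolValue_of_left (fun y hy => ?_) hr
  have hx : x ≤ rightWall t G := h.le_rightWall_iff.2 fun j =>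
    not_lt.1 fun hlt => hr j ((hasStops t _).le_of_lt _ hlt)
  obtain ⟨i, hi⟩ := h.lt_leftWall_iff.1
    (hy.trans_le (hx.trans ((hasThermograph G).rightWall_le_leftWall t)))
  exact ⟨i, (hasStops t _).ge_of_lt _ hi⟩

/-- A bound on the walls at a temperature `s < t` bounds the game cooled by `t` weakly, and not
only up to infinitesimals. -/
theorem coolValue_bounds_of_lt_above {s t : ZHalf} (hst : s < t) (G : FormalGame) :
    (∀ x, rightWall s G ≤ x + s → ¬ numValue (x + t) ≤ coolValue t G) ∧
      ∀ x, leftWall s G ≤ x → coolValue t G ≤ numValue x := by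
  induction G with
  | mk L R ihL ihR =>
    have hG := hasThermograph (mk L R)
    refine ⟨fun x hx => ?_, fun x hx => ?_⟩
    · have hlip : rightWall t (mk L R) - t ≤ rightWall s (mk L R) - s :=
        hG.rightWall_sub_antitone hst.le
      -- The stops settle everything except a tie, where the right wall has risen with slope `1` all
      -- the way from `s` to `t`.
      rcases lt_or_ge (rightWall t (mk L R)) (x + t) with hlt | hge
      · exact (hasStops t _).not_ge_of_lt _ hlt
      by_cases h : Active t (mk L R)
      · intro hc
        have hex : ∃ j, leftWall s ((mk L R).right j) ≤ x := by
          obtain ⟨j, hj⟩ := exists_finMin_eq (numRight_pos h.1)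
            fun j => leftWall s ((mk L R).right j) + s
          rw [(h.of_le hst.le).rightWall_eq, rightScaffold, hj] at hx
          exact ⟨j, by linarith⟩
        obtain ⟨j, hj⟩ := hex
        refine h.not_right_le_coolValue j (le_trans ?_ hc)
        rw [numValue_add]
        exact add_le_add_left ((ihR j).2 x hj) _
      -- A frozen wall is constant on a final interval `[r, t]` with `r < t`, so there is no tie.
      · obtain ⟨r, hsr, hrt, hr⟩ := exists_settled_lt h hst
        have h₁ := (hr.walls_eq hrt.le).2
        have h₂ : rightWall r (mk L R) - r ≤ rightWall s (mk L R) - s :=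
          hG.rightWall_sub_antitone hsr
        exact absurd hge (not_le.2 (by linarith [h₁.1, h₁.2]))
    · have hanti : leftWall t (mk L R) ≤ leftWall s (mk L R) := hG.leftWall_antitone hst.le
      by_cases h : Active t (mk L R)
      · refine h.coolValue_le_numValue fun i => (ihL i).1 x ?_
        exact (h.of_le hst.le).leftWall_le_iff.1 hx i
      · rw [coolValue_of_not_active h, numValue_le_numValue]
        exact hanti.trans hx

/-- The mirror image of `coolValue_bounds_of_lt_above`, with the players exchanged. -/
theorem coolValue_bounds_of_lt_below {s t : ZHalf} (hst : s < t) (G : FormalGame) :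
    (∀ x, x - s ≤ leftWall s G → ¬ coolValue t G ≤ numValue (x - t)) ∧
      ∀ x, x ≤ rightWall s G → numValue x ≤ coolValue t G := by
  induction G with
  | mk L R ihL ihR =>
    have hG := hasThermograph (mk L R)
    refine ⟨fun x hx => ?_, fun x hx => ?_⟩
    · have hlip : leftWall s (mk L R) + s ≤ leftWall t (mk L R) + t :=
        hG.leftWall_add_monotone hst.le
      rcases lt_or_ge (x - t) (leftWall t (mk L R)) with hlt | hge
      · exact (hasStops t _).not_le_of_lt _ hlt
      by_cases h : Active t (mk L R)
      · intro hc
        have hex : ∃ i, x ≤ rightWall s ((mk L R).left i) := by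
          obtain ⟨i, hi⟩ := exists_finMax_eq (numLeft_pos h.1)
            fun i => rightWall s ((mk L R).left i) - s
          rw [(h.of_le hst.le).leftWall_eq, leftScaffold, hi] at hx
          exact ⟨i, by linarith⟩
        obtain ⟨i, hi⟩ := hex
        refine h.not_coolValue_le_left i (hc.trans ?_)
        rw [numValue_sub]
        exact sub_le_sub_right ((ihL i).2 x hi) _
      · obtain ⟨r, hsr, hrt, hr⟩ := exists_settled_lt h hst
        have h₁ := (hr.walls_eq hrt.le).1
        have h₂ : leftWall s (mk L R) + s ≤ leftWall r (mk L R) + r :=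
          hG.leftWall_add_monotone hsr
        exact absurd hge (not_le.2 (by linarith))
    · have hmono : rightWall s (mk L R) ≤ rightWall t (mk L R) := hG.rightWall_monotone hst.le
      by_cases h : Active t (mk L R)
      · refine h.numValue_le_coolValue fun j => (ihR j).1 x ?_
        exact (h.of_le hst.le).le_rightWall_iff.1 hx j
      · rw [coolValue_of_not_active h, numValue_le_numValue]
        exact (hx.trans hmono).trans_eq ((settled_of_not_active h).walls_eq le_rfl).2.2

/-! ### Cooling respects the order -/

theorem leftWall_le_of_coolValue_le {t : ZHalf} {G H : FormalGame}
    (h : coolValue t H ≤ coolValue t G) : leftWall t H ≤ leftWall t G := by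
  by_contra! hlt
  obtain ⟨y, h₁, h₂⟩ := exists_strictly_between hlt
  exact (hasStops t H).not_le_of_lt y h₂ (h.trans ((hasStops t G).le_of_lt y h₁))

theorem rightWall_le_of_not_coolValue_le {t : ZHalf} {G H : FormalGame}
    (h : ¬ coolValue t G ≤ coolValue t H - numValue t) : rightWall t H ≤ leftWall t G + t := by
  by_contra! hlt
  obtain ⟨y, h₁, h₂⟩ := exists_strictly_between hlt
  refine h (((hasStops t G).le_of_lt (y - t) (by linarith)).trans ?_)
  rw [numValue_sub]
  exact sub_le_sub_right ((hasStops t H).ge_of_lt y h₂) _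

/-- For `G = n` the hypothesis says that the integer floor of `H` is at most `n - 1`. This is a
bound on the right wall at `-1`, which carries over to `t > -1`. -/
theorem not_coolValue_le_of_isInt_left {t : ZHalf} (ht : -1 < t) {G H : FormalGame}
    (hG : IsInt G) (h : ¬ G ≤ H) : ¬ coolValue t G ≤ coolValue t H - numValue t := by
  obtain ⟨n, hn, hw⟩ := walls_of_isInt hG
  obtain ⟨m, hm⟩ := (hasThermograph H).rightWall_int
  have hnm : ¬ ofInt n ≤ H := fun h' => h (hn.1.trans h')
  rw [(hasThermograph H).ofInt_le_iff, hm, Int.cast_le, not_le] at hnm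
  have hle : rightWall (-1) H ≤ n + -1 := by
    rw [hm]
    exact_mod_cast (by omega : m ≤ n + -1)
  have := (coolValue_bounds_of_lt_above ht H).1 n hle
  rw [numValue_add, numValue, ofDyadic_intCast] at this
  rwa [le_sub_iff_add_le, coolValue, (hw t).2.2]

theorem not_coolValue_le_of_isInt_right {t : ZHalf} (ht : -1 < t) {G H : FormalGame}
    (hH : IsInt H) (h : ¬ G ≤ H) : ¬ coolValue t G ≤ coolValue t H - numValue t := by
  obtain ⟨n, hn, hw⟩ := walls_of_isInt hH
  obtain ⟨m, hm⟩ := (hasThermograph G).leftWall_int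
  have hnm : ¬ G ≤ ofInt n := fun h' => h (h'.trans hn.2)
  rw [(hasThermograph G).le_ofInt_iff, hm, Int.cast_le, not_le] at hnm
  have hle : (n : ZHalf) - -1 ≤ leftWall (-1) G := by
    rw [hm]
    exact_mod_cast (by omega : n - -1 ≤ m)
  have := (coolValue_bounds_of_lt_below ht G).1 n hle
  rw [numValue_sub, numValue, ofDyadic_intCast] at this
  rwa [coolValue, coolValue, (hw t).2.2]

/-- While `G` is active, the taxed move to `G^L` is decisive. Later, the wall inequality at
`meetTime G`, where that move still exists, is carried forward to `t`; this is why `h` is needed at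
temperatures other than `t`. -/
theorem not_coolValue_le_of_left {t : ZHalf} (ht : -1 < t) {G H : FormalGame} (hG : ¬ IsInt G)
    (i : Fin G.numLeft) (h : ∀ s, -1 < s → coolValue s H ≤ coolValue s (G.left i)) :
    ¬ coolValue t G ≤ coolValue t H - numValue t := by
  have active : ∀ s, -1 < s → Active s G → ¬ coolValue s G ≤ coolValue s H - numValue s :=
    fun s hs ha hc => ha.not_coolValue_le_left i (hc.trans (sub_le_sub_right (h s hs) _))
  by_cases ha : Active t G
  · exact active t ht ha
  have hlt : meetTime G < t := not_le.1 fun h' => ha ⟨hG, h'⟩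
  have hle := rightWall_le_of_not_coolValue_le
    (active _ ((hasThermograph G).neg_one_lt_meetTime hG) ⟨hG, le_rfl⟩)
  have hset : Settled (meetTime G) G := fun _ => le_rfl
  rw [(hset.walls_eq hlt.le).1] at hle
  have := (coolValue_bounds_of_lt_above hlt H).1 _ hle
  rwa [coolValue_of_not_active ha, le_sub_iff_add_le, ← numValue_add]

theorem not_coolValue_le_of_right {t : ZHalf} (ht : -1 < t) {G H : FormalGame} (hH : ¬ IsInt H)
    (j : Fin H.numRight) (h : ∀ s, -1 < s → coolValue s (H.right j) ≤ coolValue s G) :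
    ¬ coolValue t G ≤ coolValue t H - numValue t := by
  have active : ∀ s, -1 < s → Active s H → ¬ coolValue s G ≤ coolValue s H - numValue s :=
    fun s hs ha hc => ha.not_right_le_coolValue j
      (le_sub_iff_add_le.1 ((h s hs).trans hc))
  by_cases ha : Active t H
  · exact active t ht ha
  have hlt : meetTime H < t := not_le.1 fun h' => ha ⟨hH, h'⟩
  have hle := rightWall_le_of_not_coolValue_le
    (active _ ((hasThermograph H).neg_one_lt_meetTime hH) ⟨hH, le_rfl⟩)
  have hset : Settled (meetTime H) H := fun _ => le_rfl
  rw [(hset.walls_eq hlt.le).2.1, ← sub_le_iff_le_add] at hle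
  have := (coolValue_bounds_of_lt_below hlt G).1 _ hle
  rwa [coolValue_of_not_active ha, ← numValue_sub]

/-- If just one game is frozen, its options are lost, but number avoidance makes them irrelevant. -/
theorem coolValue_le_of_active {t : ZHalf} {G H : FormalGame} (h : Active t G ∨ Active t H)
    (hl : ∀ i, ¬ coolValue t G ≤ coolValue t (H.left i) - numValue t)
    (hr : ∀ j, ¬ coolValue t (G.right j) ≤ coolValue t H - numValue t) :
    coolValue t H ≤ coolValue t G := by
  by_cases hH : Active t H
  · by_cases hG : Active t G
    · exact hH.coolValue_le_coolValue hG hl fun j => by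
        rw [← le_sub_iff_add_le]
        exact hr j
    · rw [coolValue_of_not_active hG] at hl ⊢
      refine hH.coolValue_le_numValue fun i => ?_
      rw [numValue_add, ← le_sub_iff_add_le]
      exact hl i
  · have hG := h.resolve_right hH
    rw [coolValue_of_not_active hH] at hr ⊢
    refine hG.numValue_le_coolValue fun j => ?_
    rw [numValue_sub]
    exact hr j

/-- Two frozen games are numbers, compared through their left walls at the later freezing
temperature, where one game is still active and both walls are final. Two integers are compared
directly. -/
theorem coolValue_le_of_forall_active {t : ZHalf} (ht : -1 < t) {G H : FormalGame} (hHG : H ≤ G)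
    (h : ∀ s, -1 < s → Active s G ∨ Active s H → coolValue s H ≤ coolValue s G) :
    coolValue t H ≤ coolValue t G := by
  by_cases hG : Active t G
  · exact h t ht (Or.inl hG)
  by_cases hH : Active t H
  · exact h t ht (Or.inr hH)
  have key : ∀ s, -1 < s → s ≤ t → Active s G ∨ Active s H → Settled s G → Settled s H →
      coolValue t H ≤ coolValue t G := by
    intro s hs hst ha hsG hsH
    have := leftWall_le_of_coolValue_le (h s hs ha)
    rw [(hsG.walls_eq hst).1, (hsH.walls_eq hst).1] at this
    rwa [coolValue_of_not_active hG, coolValue_of_not_active hH, numValue_le_numValue]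
  have hGt := settled_of_not_active hG
  have hHt := settled_of_not_active hH
  by_cases iG : IsInt G
  · by_cases iH : IsInt H
    · obtain ⟨n, hn, hw⟩ := walls_of_isInt iG
      obtain ⟨m, hm, hw'⟩ := walls_of_isInt iH
      rw [coolValue, coolValue, (hw t).2.2, (hw' t).2.2]
      exact hm.2.trans (hHG.trans hn.1)
    · exact key (meetTime H) ((hasThermograph H).neg_one_lt_meetTime iH) (hHt iH)
        (Or.inr ⟨iH, le_rfl⟩) (fun h' => absurd iG h') fun _ => le_rfl
  · by_cases iH : IsInt H
    · exact key (meetTime G) ((hasThermograph G).neg_one_lt_meetTime iG) (hGt iG)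
        (Or.inl ⟨iG, le_rfl⟩) (fun _ => le_rfl) fun h' => absurd iH h'
    · rcases le_total (meetTime G) (meetTime H) with hle | hle
      · exact key (meetTime H) ((hasThermograph H).neg_one_lt_meetTime iH) (hHt iH)
          (Or.inr ⟨iH, le_rfl⟩) (fun _ => hle) fun _ => le_rfl
      · exact key (meetTime G) ((hasThermograph G).neg_one_lt_meetTime iG) (hGt iG)
          (Or.inl ⟨iG, le_rfl⟩) (fun _ => le_rfl) fun _ => hle

/-- The quantifier over `t` lies inside the induction, since frozen games appeal to smaller pairs at
lower temperatures. -/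
theorem coolValue_order (G H : FormalGame) :
    (H ≤ G → ∀ t, -1 < t → coolValue t H ≤ coolValue t G) ∧
      (¬ G ≤ H → ∀ t, -1 < t → ¬ coolValue t G ≤ coolValue t H - numValue t) := by
  constructor
  · intro h t ht
    have h' := (le_def _ _).1 h
    refine coolValue_le_of_forall_active ht h fun s hs ha => coolValue_le_of_active ha ?_ ?_
    · exact fun i => (coolValue_order G (H.left i)).2 (h'.1 i) s hs
    · exact fun j => (coolValue_order (G.right j) H).2 (h'.2 j) s hs
  · intro h t ht
    by_cases hG : IsInt G
    · exact not_coolValue_le_of_isInt_left ht hG h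
    by_cases hH : IsInt H
    · exact not_coolValue_le_of_isInt_right ht hH h
    rw [le_def, not_and_or] at h
    push Not at h
    rcases h with ⟨i, hi⟩ | ⟨j, hj⟩
    · exact not_coolValue_le_of_left ht hG i ((coolValue_order (G.left i) H).1 hi)
    · exact not_coolValue_le_of_right ht hH j ((coolValue_order G (H.right j)).1 hj)
termination_by G.birthday + H.birthday
decreasing_by
  · have := birthday_left H i; omega
  · have := birthday_right G j; omega
  · have := birthday_left G i; omega
  · have := birthday_right H j; omega

end FormalGame

theorem theorem6p1 (t : ZHalf) (ht : -1 < t) :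
    (∀ G H : FormalGame, G ≥ H → FormalGame.cool t G ≥ FormalGame.cool t H) ∧
    (∀ G H : FormalGame, FormalGame.GreaterOrFuzzy G H →
      FormalGame.GreaterOrFuzzy (FormalGame.cool t G)
        (FormalGame.cool t H - FormalGame.ofDyadic t)) ∧
    (∀ G H : FormalGame, FormalGame.Equal G H →
      FormalGame.Equal (FormalGame.cool t G) (FormalGame.cool t H)) ∧
    ∃! f : FormalGame.Value → FormalGame.Value,
      ∀ G : FormalGame, f (FormalGame.value G) = FormalGame.value (FormalGame.cool t G) := by
  have mono : ∀ G H : FormalGame, G ≥ H → FormalGame.cool t G ≥ FormalGame.cool t H :=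
    fun G H h => (FormalGame.coolValue_order G H).1 h t ht
  have congr : ∀ G H : FormalGame, FormalGame.Equal G H →
      FormalGame.Equal (FormalGame.cool t G) (FormalGame.cool t H) :=
    fun G H h => ⟨mono H G h.1, mono G H h.2⟩
  refine ⟨mono, fun G H h => ?_, congr, ?_⟩
  · rw [FormalGame.greaterOrFuzzy_iff] at h ⊢
    rw [← FormalGame.value_le_value, FormalGame.value_sub]
    exact (FormalGame.coolValue_order G H).2 h t ht
  · refine ⟨Quotient.map (FormalGame.cool t) congr, fun G => rfl, fun f hf => funext fun a => ?_⟩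
    obtain ⟨G, rfl⟩ := FormalGame.value_surjective a
    exact hf G
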